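/- Let $d\ge 2$, $m\ge 1$, let $O\subseteq\mathbb R^d$ be open and let $D\subseteq\partial O$ be closed. Put $N:=\partial O\setminus D$ and $N_\delta:=\{z\in\mathbb R^d:\operatorname{dist}(z,N)<\delta\}$ (with $N_\delta=\emptyset$ if $N=\emptyset$). Assume that $O$ is *locally uniform near* $N$, i.e. there are $\varepsilon\in(0,1]$, $\delta\in(0,\infty]$ and $c>0$ such that (a) all $x,y\in O\cap N_\delta$ with $|x-y|<\delta$ can be joined by a rectifiable curve $\gamma\subseteq O$ of length at most $\varepsilon^{-1}|x-y|$ such that $\operatorname{dist}(z,\partial O\cap N_\delta)\ge \varepsilon\,|z-x|\,|z-y|/|x-y|$ for all $z\in\gamma$; (b) every connected component $O'$ of $O$ with $\partial O'\cap N\ne\emptyset$ satisfies $\operatorname{diam}(O')\ge c$. For an open set $U\subseteq\mathbb R^d$ and a closed set $E\subseteq\partial U$ let $W^{1,2}(U)^m$ be the space of $u\in L^2(U)^m=L^2(U;\mathbb C^m)$ with weak gradient $\nabla u\in L^2(U)^{dm}$, normed by $\|u\|_{W^{1,2}(U)^m}=(\|u\|_2^2+\|\nabla u\|_2^2)^{1/2}$,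 and let $W^{1,2}_E(U)^m$ be the closure in $W^{1,2}(U)^m$ of the set of restrictions $\varphi|_U$ with $\varphi\in C_0^\infty(\mathbb R^d)^m$ and $\operatorname{dist}(\operatorname{supp}\varphi,E)>0$. Let $a_{kl},b_k,c_l,d_0:O\to\mathcal L(\mathbb C^m)$, $1\le k,l\le d$, be bounded and measurable, and let $$a_{U}(u,v)=\int_U \sum_{k,l=1}^d a_{kl}\,\partial_l u\cdot\overline{\partial_k v}+\sum_{k=1}^d b_k u\cdot\overline{\partial_k v}+\sum_{l=1}^d c_l\,\partial_l u\cdot\overline v+d_0u\cdot\overline v\,dx .$$ Assume that there is $\lambda>0$ with $\operatorname{Re}a_O(u,u)\ge\lambda\,(\|u\|_2^2+\|\nabla u\|_2^2)$ for all $u\in W^{1,2}_D(O)^m$. Let $L$ be the operator in $L^2(O)^m$ associated with $a_O$ on $W^{1,2}_D(O)^m$: $u\in\operatorname{dom}(L)$ and $Lu=f$ if and only if $u\in W^{1,2}_D(O)^m$, $f\in L^2(O)^m$ and $a_O(u,v)=(f\,|\,v)_{2}$ for all $v\in W^{1,2}_D(O)^m$. Suppose that $O=\bigcup_i O_i$ with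 pairwise disjoint open sets $O_i$, put $D_i:=D\cap\partial O_i$, and let $L_i$ be the operator in $L^2(O_i)^m$ associated in the same way with $a_{O_i}$ (that is, with the coefficients restricted to $O_i$) on $W^{1,2}_{D_i}(O_i)^m$. The square roots $\sqrt L$ and $\sqrt{L_i}$ are defined through the functional calculus for sectorial operators. Then the following are equivalent: (i) $\operatorname{dom}(\sqrt L)=W^{1,2}_D(O)^m$, and there are constants $C_1,C_2>0$ with $C_1\|u\|_{W^{1,2}(O)^m}\le\|\sqrt L\,u\|_2\le C_2\|u\|_{W^{1,2}(O)^m}$ for all $u\in W^{1,2}_D(O)^m$; (ii) there are constants $C_1,C_2>0$, independent of $i$, such that for every $i$ one has $\operatorname{dom}(\sqrt{L_i})=W^{1,2}_{D_i}(O_i)^m$ and $C_1\|u\|_{W^{1,2}(O_i)^m}\le\|\sqrt{L_i}\,u\|_2\le C_2\|u\|_{W^{1,2}(O_i)^m}$ for all $u\in W^{1,2}_{D_i}(O_i)^m$. Moreover, for any given $C_1,C_2>0$, (i) holds with these constants if and only if (ii) holds with these constants. -/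

import Mathlib

open MeasureTheory Set
open scoped ENNReal ContDiff

noncomputable section

namespace KatoRoot

/-! ### Geometry -/

/-- Euclidean space `ℝ^d`. -/
abbrev Rd (d : ℕ) := EuclideanSpace ℝ (Fin d)

/-- The Hilbert space `ℂ^m`. -/
abbrev Cm (m : ℕ) := EuclideanSpace ℂ (Fin m)

/-- `N_δ = {z : dist(z, N) < δ}`; it is empty if `N` is empty. -/
def nbhd {d : ℕ} (N : Set (Rd d)) (δ : ℝ≥0∞) : Set (Rd d) :=
  {z | Metric.infEDist z N < δ}

/-- `x` and `y` can be joined in `O` by an `ε`-cigar with respect to the set `F`. -/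
def JoinedByCigar {d : ℕ} (O F : Set (Rd d)) (ε : ℝ) (x y : Rd d) : Prop :=
  ∃ γ : ℝ → Rd d, ContinuousOn γ (Icc 0 1) ∧ γ 0 = x ∧ γ 1 = y ∧
    (∀ t ∈ Icc (0 : ℝ) 1, γ t ∈ O) ∧
    eVariationOn γ (Icc 0 1) ≤ ENNReal.ofReal (ε⁻¹ * dist x y) ∧
    ∀ t ∈ Icc (0 : ℝ) 1,
      ENNReal.ofReal (ε * dist (γ t) x * dist (γ t) y / dist x y) ≤ Metric.infEDist (γ t) F

/-- `O` is locally an `(ε, δ)`-domain near `N`. -/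
def IsLocallyEpsDelta {d : ℕ} (O N : Set (Rd d)) (ε : ℝ) (δ : ℝ≥0∞) : Prop :=
  (∀ x ∈ O ∩ nbhd N δ, ∀ y ∈ O ∩ nbhd N δ, edist x y < δ →
    JoinedByCigar O (frontier O ∩ nbhd N δ) ε x y) ∧
  ∃ c : ℝ, 0 < c ∧ ∀ x ∈ O,
    (frontier (connectedComponentIn O x) ∩ N).Nonempty →
      ENNReal.ofReal c ≤ Metric.ediam (connectedComponentIn O x)

/-- `O` is locally uniform near `N`. -/
def IsLocallyUniformNear {d : ℕ} (O N : Set (Rd d)) : Prop :=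
  ∃ (ε : ℝ) (δ : ℝ≥0∞), 0 < ε ∧ ε ≤ 1 ∧ 0 < δ ∧ IsLocallyEpsDelta O N ε δ

/-! ### Sobolev spaces -/

/-- `L²(O)^m`. -/
abbrev L2 {d : ℕ} (O : Set (Rd d)) (m : ℕ) := Lp (Cm m) 2 (volume.restrict O)

/-- Pairs `(u, (g_i)_i)` in `L²(O)^m × (L²(O)^m)^d`, with the Hilbert norm
`(‖u‖² + ∑ i, ‖g_i‖²)^(1/2)`. -/
abbrev Jet {d : ℕ} (O : Set (Rd d)) (m : ℕ) :=
  WithLp 2 (L2 O m × PiLp 2 (fun _ : Fin d => L2 O m))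

/-- The classical partial derivative in direction `i`. -/
def partialDeriv {d : ℕ} (i : Fin d) (φ : Rd d → ℝ) (x : Rd d) : ℝ :=
  fderiv ℝ φ x (EuclideanSpace.single i 1)

/-- `g` is the weak (distributional) `i`-th partial derivative of `u` on `O`. -/
def IsWeakPartial {d m : ℕ} (O : Set (Rd d)) (i : Fin d) (u g : L2 O m) : Prop :=
  ∀ φ : Rd d → ℝ, ContDiff ℝ ∞ φ → HasCompactSupport φ → tsupport φ ⊆ O →
    ∫ x in O, partialDeriv i φ x • u x = - ∫ x in O, φ x • g x

lemma integrable_smul_L2 {d m : ℕ} {O : Set (Rd d)} (φ : Rd d → ℝ) (hφ : Continuous φ)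
    (hc : HasCompactSupport φ) (u : L2 O m) :
    Integrable (fun x => φ x • u x) (volume.restrict O) :=
  ((Lp.memLp u).locallyIntegrable (by norm_num)).integrable_smul_left_of_hasCompactSupport hφ hc

lemma continuous_partialDeriv {d : ℕ} (i : Fin d) {φ : Rd d → ℝ} (hφ : ContDiff ℝ ∞ φ) :
    Continuous (partialDeriv i φ) :=
  (hφ.continuous_fderiv (by simp)).clm_apply continuous_const

lemma hasCompactSupport_partialDeriv {d : ℕ} (i : Fin d) {φ : Rd d → ℝ}
    (hφ : HasCompactSupport φ) : HasCompactSupport (partialDeriv i φ) :=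
  hφ.fderiv_apply (𝕜 := ℝ) (EuclideanSpace.single i 1)

lemma integral_smul_L2_add {d m : ℕ} {O : Set (Rd d)} (φ : Rd d → ℝ) (hφ : Continuous φ)
    (hc : HasCompactSupport φ) (u v : L2 O m) :
    ∫ x in O, φ x • (u + v : L2 O m) x = (∫ x in O, φ x • u x) + ∫ x in O, φ x • v x := by
  rw [← integral_add (integrable_smul_L2 φ hφ hc u) (integrable_smul_L2 φ hφ hc v)]
  refine integral_congr_ae ?_
  filter_upwards [Lp.coeFn_add u v] with x hx
  rw [hx, Pi.add_apply, smul_add]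

lemma integral_smul_L2_smul {d m : ℕ} {O : Set (Rd d)} (φ : Rd d → ℝ) (k : ℂ) (u : L2 O m) :
    ∫ x in O, φ x • (k • u : L2 O m) x = k • ∫ x in O, φ x • u x := by
  rw [← integral_smul]
  refine integral_congr_ae ?_
  filter_upwards [Lp.coeFn_smul k u] with x hx
  simp only [hx, Pi.smul_apply]
  rw [smul_comm]

/-- The Hilbert space `W^{1,2}(O)^m`, an element `u` being stored as the pair `(u, ∇u)`. -/
def W12 {d : ℕ} (O : Set (Rd d)) (m : ℕ) : Submodule ℂ (Jet O m) where
  carrier := {w | ∀ i, IsWeakPartial O i w.fst (w.snd i)}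
  zero_mem' := by
    intro i φ _ _ _
    have h : ∀ ψ : Rd d → ℝ, ∫ x in O, ψ x • (0 : L2 O m) x = 0 := by
      intro ψ
      rw [← integral_zero (Rd d) (Cm m) (μ := volume.restrict O)]
      refine integral_congr_ae ?_
      filter_upwards [Lp.coeFn_zero (Cm m) 2 (volume.restrict O)] with x hx
      rw [hx, Pi.zero_apply, smul_zero]
    exact (h _).trans (neg_eq_zero.mpr (h φ)).symm
  add_mem' := by
    intro v w hv hw i φ h1 h2 h3
    have e1 := integral_smul_L2_add (partialDeriv i φ) (continuous_partialDeriv i h1)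
      (hasCompactSupport_partialDeriv i h2) v.fst w.fst
    have e2 := integral_smul_L2_add φ h1.continuous h2 (v.snd i) (w.snd i)
    have e3 := hv i φ h1 h2 h3
    have e4 := hw i φ h1 h2 h3
    simp only [WithLp.add_fst, WithLp.add_snd, PiLp.add_apply]
    rw [e1, e2, e3, e4]
    abel
  smul_mem' := by
    intro k v hv i φ h1 h2 h3
    have e1 := integral_smul_L2_smul (partialDeriv i φ) k v.fst
    have e2 := integral_smul_L2_smul φ k (v.snd i)
    have e3 := hv i φ h1 h2 h3
    simp only [WithLp.smul_fst, WithLp.smul_snd, PiLp.smul_apply]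
    rw [e1, e2, e3]
    simp

/-- `φ ∈ C_0^∞(ℝ^d)^m` with `dist(supp φ, D) > 0`. -/
def IsTestFunction {d m : ℕ} (D : Set (Rd d)) (φ : Rd d → Cm m) : Prop :=
  ContDiff ℝ ∞ φ ∧ HasCompactSupport φ ∧
    ∃ r : ℝ, 0 < r ∧ ∀ x ∈ tsupport φ, ∀ y ∈ D, r ≤ dist x y

/-- `C_D^∞(O)^m` as a subspace of `W^{1,2}(O)^m`: the restrictions to `O` of test functions. -/
def CDinfty {d : ℕ} (O D : Set (Rd d)) (m : ℕ) : Submodule ℂ (W12 O m) where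
  carrier := {w | ∃ φ : Rd d → Cm m, IsTestFunction D φ ∧
    (w : Jet O m).fst =ᵐ[volume.restrict O] φ}
  zero_mem' := ⟨0, ⟨contDiff_const, HasCompactSupport.zero, 1, one_pos, by simp [tsupport]⟩,
    Lp.coeFn_zero (Cm m) 2 (volume.restrict O)⟩
  add_mem' := by
    rintro v w ⟨φ, ⟨h1, h2, r, hr, h3⟩, h4⟩ ⟨ψ, ⟨k1, k2, s, hs, k3⟩, k4⟩
    refine ⟨φ + ψ, ⟨h1.add k1, h2.add k2, min r s, lt_min hr hs, ?_⟩, ?_⟩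
    · intro x hx y hy
      rcases tsupport_add φ ψ hx with hx | hx
      · exact (min_le_left _ _).trans (h3 x hx y hy)
      · exact (min_le_right _ _).trans (k3 x hx y hy)
    · filter_upwards [h4, k4, Lp.coeFn_add (v : Jet O m).fst (w : Jet O m).fst] with x a b c
      simp only [Submodule.coe_add, WithLp.add_fst, c, Pi.add_apply, a, b]
  smul_mem' := by
    rintro k v ⟨φ, ⟨h1, h2, r, hr, h3⟩, h4⟩
    refine ⟨k • φ, ⟨h1.const_smul k, h2.smul_left (f := fun _ => k), r, hr, ?_⟩, ?_⟩
    · intro x hx y hy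
      exact h3 x (closure_mono (Function.support_const_smul_subset k φ) hx) y hy
    · filter_upwards [h4, Lp.coeFn_smul k (v : Jet O m).fst] with x a c
      simp only [Submodule.coe_smul, WithLp.smul_fst, c, Pi.smul_apply, a]

/-- `W^{1,2}_D(O)^m`, the closure of `C_D^∞(O)^m` in `W^{1,2}(O)^m`. -/
def W12D {d : ℕ} (O D : Set (Rd d)) (m : ℕ) : Submodule ℂ (W12 O m) :=
  (CDinfty O D m).topologicalClosure

/-- The function underlying an element of `W^{1,2}(O)^m`, as a linear map into `L²(O)^m`. -/
def toL2 {d : ℕ} (O : Set (Rd d)) (m : ℕ) : W12 O m →ₗ[ℂ] L2 O m where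
  toFun w := (w : Jet O m).fst
  map_add' _ _ := rfl
  map_smul' _ _ := rfl

/-- The weak partial derivative `∂_i u`, as a linear map into `L²(O)^m`. -/
def grad {d : ℕ} (O : Set (Rd d)) (m : ℕ) (i : Fin d) : W12 O m →ₗ[ℂ] L2 O m where
  toFun w := (w : Jet O m).snd i
  map_add' _ _ := rfl
  map_smul' _ _ := rfl

/-! ### The divergence form operator -/

/-- `M` is a bounded and measurable `ℒ(ℂ^m)`-valued coefficient on `O`. -/
def IsBddMeas {d m : ℕ} (O : Set (Rd d)) (M : Rd d → (Cm m →L[ℂ] Cm m)) : Prop :=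
  AEStronglyMeasurable M (volume.restrict O) ∧ ∃ Λ : ℝ, ∀ᵐ x ∂(volume.restrict O), ‖M x‖ ≤ Λ

/-- Bounded measurable coefficients `a_{ij}, b_i, c_j, d : O → ℒ(ℂ^m)`.
Values outside `O` are irrelevant. -/
structure Coeff {d : ℕ} (O : Set (Rd d)) (m : ℕ) where
  a : Fin d → Fin d → Rd d → (Cm m →L[ℂ] Cm m)
  b : Fin d → Rd d → (Cm m →L[ℂ] Cm m)
  c : Fin d → Rd d → (Cm m →L[ℂ] Cm m)
  d : Rd d → (Cm m →L[ℂ] Cm m)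
  ha : ∀ i j, IsBddMeas O (a i j)
  hb : ∀ i, IsBddMeas O (b i)
  hc : ∀ j, IsBddMeas O (c j)
  hd : IsBddMeas O d

lemma IsBddMeas.mono {d m : ℕ} {O O' : Set (Rd d)} (h : O' ⊆ O)
    {M : Rd d → (Cm m →L[ℂ] Cm m)} (hM : IsBddMeas O M) : IsBddMeas O' M :=
  ⟨hM.1.mono_measure (Measure.restrict_mono h le_rfl),
    hM.2.imp fun _ hΛ => ae_mono (Measure.restrict_mono h le_rfl) hΛ⟩

/-- Restriction of the coefficients to a smaller set. -/
def Coeff.restrict {d m : ℕ} {O O' : Set (Rd d)} (A : Coeff O m) (h : O' ⊆ O) : Coeff O' m where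
  a := A.a
  b := A.b
  c := A.c
  d := A.d
  ha i j := (A.ha i j).mono h
  hb i := (A.hb i).mono h
  hc j := (A.hc j).mono h
  hd := A.hd.mono h

/-- `∫_O M u · conj(v) dx`. -/
def pairing {d m : ℕ} (O : Set (Rd d)) (M : Rd d → (Cm m →L[ℂ] Cm m)) (u v : L2 O m) : ℂ :=
  ∫ x in O, inner ℂ (v x) (M x (u x))

lemma integrable_pairing {d m : ℕ} {O : Set (Rd d)} {M : Rd d → (Cm m →L[ℂ] Cm m)}
    (hM : IsBddMeas O M) (u v : L2 O m) :
    Integrable (fun x => inner ℂ (v x) (M x (u x))) (volume.restrict O) := by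
  obtain ⟨h1, Λ, hΛ⟩ := hM
  have hmeas : AEStronglyMeasurable (fun x => M x (u x)) (volume.restrict O) :=
    isBoundedBilinearMap_apply.continuous.comp_aestronglyMeasurable
      (h1.prodMk (Lp.aestronglyMeasurable u))
  have hmem : MemLp (fun x => M x (u x)) 2 (volume.restrict O) := by
    refine (Lp.memLp u).of_le_mul (c := Λ) hmeas ?_
    filter_upwards [hΛ] with x hx
    exact ((M x).le_opNorm _).trans (mul_le_mul_of_nonneg_right hx (norm_nonneg _))
  refine (L2.integrable_inner (𝕜 := ℂ) v (hmem.toLp _)).congr ?_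
  filter_upwards [hmem.coeFn_toLp] with x hx
  rw [hx]

lemma pairing_add {d m : ℕ} {O : Set (Rd d)} {M : Rd d → (Cm m →L[ℂ] Cm m)}
    (hM : IsBddMeas O M) (u u' v : L2 O m) :
    pairing O M (u + u') v = pairing O M u v + pairing O M u' v := by
  unfold pairing
  rw [← integral_add (integrable_pairing hM u v) (integrable_pairing hM u' v)]
  refine integral_congr_ae ?_
  filter_upwards [Lp.coeFn_add u u'] with x hx
  rw [hx, Pi.add_apply, map_add, inner_add_right]

lemma pairing_smul {d m : ℕ} {O : Set (Rd d)} (M : Rd d → (Cm m →L[ℂ] Cm m))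
    (k : ℂ) (u v : L2 O m) : pairing O M (k • u) v = k * pairing O M u v := by
  unfold pairing
  rw [← smul_eq_mul, ← integral_smul]
  refine integral_congr_ae ?_
  filter_upwards [Lp.coeFn_smul k u] with x hx
  rw [hx, Pi.smul_apply, map_smul, inner_smul_right, smul_eq_mul]

/-- The sesquilinear form
`a(u,v) = ∫_O ∑ a_ij ∂_j u · conj(∂_i v) + ∑ b_i u · conj(∂_i v) + ∑ c_j ∂_j u · conj(v)
  + d u · conj(v) dx` on `W^{1,2}(O)^m`. -/
def form {d m : ℕ} {O : Set (Rd d)} (A : Coeff O m) (u v : W12 O m) : ℂ :=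
  (∑ i, ∑ j, pairing O (A.a i j) (grad O m j u) (grad O m i v))
    + (∑ i, pairing O (A.b i) (toL2 O m u) (grad O m i v))
    + (∑ j, pairing O (A.c j) (grad O m j u) (toL2 O m v))
    + pairing O A.d (toL2 O m u) (toL2 O m v)

lemma form_add {d m : ℕ} {O : Set (Rd d)} (A : Coeff O m) (u u' v : W12 O m) :
    form A (u + u') v = form A u v + form A u' v := by
  simp only [form, map_add, pairing_add (A.ha _ _), pairing_add (A.hb _), pairing_add (A.hc _),
    pairing_add A.hd, Finset.sum_add_distrib]
  ring

lemma form_smul {d m : ℕ} {O : Set (Rd d)} (A : Coeff O m) (k : ℂ) (u v : W12 O m) :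
    form A (k • u) v = k * form A u v := by
  simp only [form, map_smul, pairing_smul, mul_add, Finset.mul_sum]

/-- The (inhomogeneous) Gårding inequality on `W^{1,2}_D(O)^m`. Here `‖u‖` is the norm of
`W^{1,2}(O)^m`, that is `‖u‖² = ‖u‖_2² + ‖∇u‖_2²`. -/
def IsElliptic {d m : ℕ} {O : Set (Rd d)} (D : Set (Rd d)) (A : Coeff O m) : Prop :=
  ∃ l : ℝ, 0 < l ∧ ∀ u ∈ W12D O D m, l * ‖u‖ ^ 2 ≤ (form A u u).re

/-- The graph of the operator `L` in `L²(O)^m` associated with the form on `W^{1,2}_D(O)^m`: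
`(u, f)` belongs to it if `u ∈ W^{1,2}_D(O)^m` and `a(u,v) = (f | v)` for all
`v ∈ W^{1,2}_D(O)^m`. -/
def divGraph {d m : ℕ} (O D : Set (Rd d)) (A : Coeff O m) :
    Submodule ℂ (L2 O m × L2 O m) where
  carrier := {p | ∃ w ∈ W12D O D m, toL2 O m w = p.1 ∧
    ∀ v ∈ W12D O D m, form A w v = inner ℂ (toL2 O m v) p.2}
  zero_mem' := by
    refine ⟨0, zero_mem _, map_zero _, fun v _ => ?_⟩
    have h := form_smul A 0 0 v
    simpa using h
  add_mem' := by
    rintro p q ⟨w, hw, h1, h2⟩ ⟨w', hw', h1', h2'⟩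
    refine ⟨w + w', add_mem hw hw', by simp [h1, h1'], fun v hv => ?_⟩
    rw [form_add, h2 v hv, h2' v hv, Prod.snd_add, inner_add_right]
  smul_mem' := by
    rintro k p ⟨w, hw, h1, h2⟩
    refine ⟨k • w, Submodule.smul_mem _ k hw, by simp [h1], fun v hv => ?_⟩
    rw [form_smul, h2 v hv, Prod.smul_snd, inner_smul_right]

/-- The divergence form operator `L` in `L²(O)^m` with Dirichlet conditions on `D`. -/
def divOp {d m : ℕ} (O D : Set (Rd d)) (A : Coeff O m) : L2 O m →ₗ.[ℂ] L2 O m :=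
  (divGraph O D A).toLinearPMap

/-! ### The square root through the sectorial functional calculus -/

section Calculus

variable {H : Type*} [NormedAddCommGroup H] [InnerProductSpace ℂ H]

/-- `R` is the bounded two-sided inverse `(z - T)⁻¹`. -/
def IsResolvent (T : H →ₗ.[ℂ] H) (z : ℂ) (R : H →L[ℂ] H) : Prop :=
  (∀ u : H, ∃ h : R u ∈ T.domain, z • R u - T ⟨R u, h⟩ = u) ∧
    ∀ u : T.domain, R (z • (u : H) - T u) = u

open scoped Classical in
/-- The resolvent `(z - T)⁻¹`, with value `0` if `z` is not in the resolvent set. -/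
def resolventOp (T : H →ₗ.[ℂ] H) (z : ℂ) : H →L[ℂ] H :=
  if h : ∃ R, IsResolvent T z R then h.choose else 0

/-- `f(T) = (2πi)⁻¹ ∫_γ f(z) (z - T)⁻¹ dz`, where `γ` is the positively oriented boundary of the
sector `{z ≠ 0 : |arg z| < ν}`: it comes from infinity to `0` along the ray `r e^{iν}` and
returns to infinity along the ray `r e^{-iν}`. -/
def sectorIntegral (T : H →ₗ.[ℂ] H) (ν : ℝ) (f : ℂ → ℂ) : H →L[ℂ] H :=
  (2 * (Real.pi : ℂ) * Complex.I)⁻¹ •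
    ((∫ r in Ioi (0 : ℝ), (f (r * Complex.exp (-(ν * Complex.I))) * Complex.exp (-(ν * Complex.I))) •
        resolventOp T (r * Complex.exp (-(ν * Complex.I))))
      - ∫ r in Ioi (0 : ℝ), (f (r * Complex.exp (ν * Complex.I)) * Complex.exp (ν * Complex.I)) •
        resolventOp T (r * Complex.exp (ν * Complex.I)))

/-- The square root `√T = e(T)⁻¹ (e √z)(T) = (1 + T) (√z / (1 + z))(T)`, with regularizer
`e(z) = (1 + z)⁻¹` and its natural domain, of a sectorial operator of angle less than `π/2`.
For such operators the boundary of the sector with `ν = π/2` is an admissible contour; the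
principal branch of `√z` is used. -/
def sqrtOp (T : H →ₗ.[ℂ] H) : H →ₗ.[ℂ] H where
  domain := T.domain.comap
    (sectorIntegral T (Real.pi / 2) fun z => z ^ (1 / 2 : ℂ) / (1 + z) : H →ₗ[ℂ] H)
  toFun :=
    let G : H →L[ℂ] H := sectorIntegral T (Real.pi / 2) fun z => z ^ (1 / 2 : ℂ) / (1 + z)
    { toFun := fun u => G u + T ⟨G u, u.2⟩
      map_add' := fun u v => by
        have h : (⟨G (u + v : H), (u + v).2⟩ : T.domain) = ⟨G u, u.2⟩ + ⟨G v, v.2⟩ :=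
          Subtype.ext (map_add G (u : H) v)
        have h' := congrArg T h
        rw [LinearPMap.map_add] at h'
        simp only [Submodule.coe_add] at h' ⊢
        rw [h', map_add]
        abel
      map_smul' := fun k u => by
        have h : (⟨G (k • u : H), (k • u).2⟩ : T.domain) = k • ⟨G u, u.2⟩ :=
          Subtype.ext (map_smul G k (u : H))
        have h' := congrArg T h
        rw [LinearPMap.map_smul] at h'
        simp only [Submodule.coe_smul, RingHom.id_apply] at h' ⊢
        rw [h', map_smul, smul_add] }

end Calculus

/-- `dom(√L) = W^{1,2}_D(O)^m`, with
`C₁ ‖u‖_{W^{1,2}(O)^m} ≤ ‖√L u‖_2 ≤ C₂ ‖u‖_{W^{1,2}(O)^m}` for all `u` in this space. -/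
def KatoWith {d m : ℕ} (O D : Set (Rd d)) (A : Coeff O m) (C₁ C₂ : ℝ) : Prop :=
  (sqrtOp (divOp O D A)).domain = (W12D O D m).map (toL2 O m) ∧
    ∀ w ∈ W12D O D m, ∀ u : (sqrtOp (divOp O D A)).domain, (u : L2 O m) = toL2 O m w →
      C₁ * ‖w‖ ≤ ‖sqrtOp (divOp O D A) u‖ ∧ ‖sqrtOp (divOp O D A) u‖ ≤ C₂ * ‖w‖

end KatoRoot

end

/-!
The square root property is inherited by orthogonal sums, and the hypotheses make all the data of
the problem split along the pieces `P i` of `O`.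

*Geometry.* Each `P i` is open and relatively closed in `O`, so that extension by zero maps
`W^{1,2}(P i)^m` into `W^{1,2}(O)^m` (`isWeakPartial_extL2`). It also respects the boundary
condition: a point of `∂(P i) \ D` lies in `N = ∂O \ D`, and points of `P i` and of `O \ P i` close
to it could be joined by a curve in `O`, which is impossible; hence `∂(P i) \ D` does not meet the
closure of `O \ P i` (`notMem_closure_diff`), and a test function for `P i` can be cut off so as to
vanish on the other pieces and near `D` (`exists_isTestFunction_of_piece`). This is the only use of
local uniformity. As a consequence `L²(O)^m` and `W^{1,2}_D(O)^m` are the Hilbert sums of the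
corresponding spaces on the pieces, restriction and extension by zero being adjoint to each other,
and both maps carry the graphs of `L` and `L_i` into one another.

*Operator theory.* By the Lax–Milgram lemma and the usual sector estimate,
`‖(z - L)⁻¹‖ ≤ K min(1, |z|⁻¹)` for imaginary `z ≠ 0` (`hasImagResolventBound_of_form`), so the
contour integral for `(√z / (1 + z))(L)` converges absolutely. Bounded operators which intertwine
two such operators intertwine their resolvents, the contour integrals, and finally the square roots
(`mem_graph_sqrtOp_of_intertwine`, `mem_graph_sqrtOp_of_forall`): `√L u = f` exactly when
`√L_i` maps the restriction of `u` to that of `f` for all `i`.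

*Conclusion.* The bounds on `O` restrict to the pieces because extension by zero is isometric. The
bounds on the pieces, squared and summed, give those on `O`; square summability of the pieces is
what puts `u` into `W^{1,2}_D(O)^m`, respectively into the domain of `√L`
(`abstractKato_iff_forall`).
-/

open MeasureTheory Set
open scoped ENNReal ContDiff

noncomputable section

namespace KatoRoot

/-! ### Hilbert sums described by restriction maps -/

section HilbertSum

variable {ι H : Type*} {G : ι → Type*} [NormedAddCommGroup H] [InnerProductSpace ℂ H]
  [CompleteSpace H] [∀ i, NormedAddCommGroup (G i)] [∀ i, InnerProductSpace ℂ (G i)]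

/-- If the maps `R i`, adjoint to the embeddings `E i`, jointly separate points, then the ranges
of the embeddings span a dense subspace: a vector orthogonal to all of them is killed by every
`R i`. -/
lemma isHilbertSum_of_separating [∀ i, CompleteSpace (G i)] {E : ∀ i, G i →ₗᵢ[ℂ] H} {R : ∀ i, H → G i}
    (hER : ∀ i x u, inner ℂ (E i x) u = inner ℂ x (R i u))
    (hE : Pairwise fun i j => ∀ x, R i (E j x) = 0)
    (hR : ∀ u, (∀ i, R i u = 0) → u = 0) : IsHilbertSum ℂ G E := by
  refine IsHilbertSum.mk (fun i j hij x y => by rw [hER, hE hij, inner_zero_right]) ?_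
  rw [top_le_iff, Submodule.topologicalClosure_eq_top_iff, Submodule.eq_bot_iff]
  refine fun u hu => hR u fun i => ?_
  have h := Submodule.inner_right_of_mem_orthogonal
    (Submodule.mem_iSup_of_mem i (LinearMap.mem_range_self (E i).toLinearMap (R i u))) hu
  exact inner_self_eq_zero.mp ((hER i (R i u) u).symm.trans h)

variable {E : ∀ i, G i →ₗᵢ[ℂ] H} {R : ∀ i, H → G i}

lemma linearIsometryEquiv_apply_of_adjoint (hE : IsHilbertSum ℂ G E)
    (hER : ∀ i x u, inner ℂ (E i x) u = inner ℂ x (R i u)) (u : H) (i : ι) :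
    hE.linearIsometryEquiv u i = R i u := by
  classical
  refine ext_inner_left ℂ fun x => ?_
  rw [← hER, ← hE.linearIsometryEquiv_symm_apply_single, LinearIsometryEquiv.inner_map_eq_flip,
    LinearIsometryEquiv.symm_symm, lp.inner_single_left]

lemma hasSum_norm_sq_of_isHilbertSum (hE : IsHilbertSum ℂ G E)
    (hER : ∀ i x u, inner ℂ (E i x) u = inner ℂ x (R i u)) (u : H) :
    HasSum (fun i => ‖R i u‖ ^ 2) (‖u‖ ^ 2) := by
  have h := lp.hasSum_norm (p := 2) (by norm_num) (hE.linearIsometryEquiv u)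
  simpa [linearIsometryEquiv_apply_of_adjoint hE hER] using h

lemma exists_of_summable_norm_sq (hE : IsHilbertSum ℂ G E)
    (hER : ∀ i x u, inner ℂ (E i x) u = inner ℂ x (R i u)) {x : ∀ i, G i}
    (hx : Summable fun i => ‖x i‖ ^ 2) : ∃ u, ∀ i, R i u = x i := by
  have hmem : Memℓp x 2 := memℓp_gen (by simpa using hx)
  refine ⟨hE.linearIsometryEquiv.symm ⟨x, hmem⟩, fun i => ?_⟩
  rw [← linearIsometryEquiv_apply_of_adjoint hE hER, LinearIsometryEquiv.apply_symm_apply]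

end HilbertSum

/-! ### Resolvents on the imaginary axis -/

section Resolvent

variable {H H' : Type*} [NormedAddCommGroup H] [InnerProductSpace ℂ H]
  [NormedAddCommGroup H'] [InnerProductSpace ℂ H']

lemma mem_graph_iff_exists {T : H →ₗ.[ℂ] H} {u f : H} :
    (u, f) ∈ T.graph ↔ ∃ h : u ∈ T.domain, T ⟨u, h⟩ = f :=
  ⟨fun h => ⟨LinearPMap.mem_domain_of_mem_graph h,
    ((LinearPMap.image_iff (LinearPMap.mem_domain_of_mem_graph h)).mpr h).symm⟩,
    fun ⟨h, hf⟩ => (LinearPMap.image_iff h).mp hf.symm⟩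

lemma IsResolvent.mem_graph_iff {T : H →ₗ.[ℂ] H} {z : ℂ} {R : H →L[ℂ] H} (hR : IsResolvent T z R)
    {u f : H} : (u, f) ∈ T.graph ↔ R (z • u - f) = u := by
  constructor
  · intro h
    obtain ⟨hu, rfl⟩ := mem_graph_iff_exists.mp h
    exact hR.2 ⟨u, hu⟩
  · intro h
    obtain ⟨hu, h'⟩ := hR.1 (z • u - f)
    refine mem_graph_iff_exists.mpr ⟨h ▸ hu, ?_⟩
    simp only [h] at h'
    exact sub_right_injective h'

lemma IsResolvent.mem_graph {T : H →ₗ.[ℂ] H} {z : ℂ} {R : H →L[ℂ] H} (hR : IsResolvent T z R)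
    (u : H) : (R u, z • R u - u) ∈ T.graph := by
  rw [hR.mem_graph_iff, sub_sub_cancel]

lemma IsResolvent.unique {T : H →ₗ.[ℂ] H} {z : ℂ} {R R' : H →L[ℂ] H} (hR : IsResolvent T z R)
    (hR' : IsResolvent T z R') : R = R' := by
  ext u
  have h := hR'.mem_graph_iff.mp (hR.mem_graph u)
  rw [sub_sub_cancel] at h
  exact h.symm

/-- The imaginary axis without `0` belongs to the resolvent set of `T`, and there
`‖(z - T)⁻¹‖ ≤ K min(1, |z|⁻¹)`. -/
def HasImagResolventBound (T : H →ₗ.[ℂ] H) : Prop :=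
  ∃ K : ℝ, ∀ t : ℝ, t ≠ 0 → ∃ R, IsResolvent T (t * Complex.I) R ∧ ‖R‖ ≤ K ∧ |t| * ‖R‖ ≤ K

lemma HasImagResolventBound.isResolvent {T : H →ₗ.[ℂ] H} (hT : HasImagResolventBound T) {t : ℝ}
    (ht : t ≠ 0) : IsResolvent T (t * Complex.I) (resolventOp T (t * Complex.I)) := by
  obtain ⟨K, hK⟩ := hT
  have h : ∃ R, IsResolvent T (t * Complex.I) R := (hK t ht).imp fun _ h => h.1
  rw [resolventOp, dif_pos h]
  exact h.choose_spec

lemma HasImagResolventBound.exists_bound {T : H →ₗ.[ℂ] H} (hT : HasImagResolventBound T) :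
    ∃ K : ℝ, ∀ t : ℝ, t ≠ 0 → ‖resolventOp T (t * Complex.I)‖ ≤ K ∧
      |t| * ‖resolventOp T (t * Complex.I)‖ ≤ K := by
  obtain ⟨K, hK⟩ := id hT
  refine ⟨K, fun t ht => ?_⟩
  obtain ⟨R, hR, h⟩ := hK t ht
  rwa [← hR.unique (hT.isResolvent ht)]

/-- A bounded operator mapping the graph of `T` into the graph of `T'` intertwines the
resolvents. -/
lemma IsResolvent.intertwine {T : H →ₗ.[ℂ] H} {T' : H' →ₗ.[ℂ] H'} {z : ℂ} {R : H →L[ℂ] H}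
    {R' : H' →L[ℂ] H'} (hR : IsResolvent T z R) (hR' : IsResolvent T' z R') (S : H →L[ℂ] H')
    (hS : ∀ u f, (u, f) ∈ T.graph → (S u, S f) ∈ T'.graph) : S ∘L R = R' ∘L S := by
  ext u
  have h := hR'.mem_graph_iff.mp (hS _ _ (hR.mem_graph u))
  rw [map_sub S, map_smul S, sub_sub_cancel] at h
  exact h.symm

/-- By the resolvent identity, a bounded resolvent is Lipschitz continuous. -/
lemma HasImagResolventBound.continuousOn {T : H →ₗ.[ℂ] H} (hT : HasImagResolventBound T) :
    ContinuousOn (fun t : ℝ => resolventOp T (t * Complex.I)) {0}ᶜ := by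
  obtain ⟨K, hK⟩ := hT.exists_bound
  have key : ∀ s ∈ ({0}ᶜ : Set ℝ), ∀ t ∈ ({0}ᶜ : Set ℝ),
      dist (resolventOp T (s * Complex.I)) (resolventOp T (t * Complex.I))
        ≤ (K * K).toNNReal * dist s t := by
    intro s hs t ht
    have hRs := hT.isResolvent hs
    have hRt := hT.isResolvent ht
    have e : resolventOp T (s * Complex.I) - resolventOp T (t * Complex.I)
        = ((t - s : ℝ) * Complex.I) •
          (resolventOp T (t * Complex.I) ∘L resolventOp T (s * Complex.I)) := by
      ext u
      have h := hRt.mem_graph_iff.mp (hRs.mem_graph u)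
      set v := resolventOp T (s * Complex.I) u
      have h2 : (t * Complex.I) • v - ((s * Complex.I) • v - u)
          = ((t - s : ℝ) * Complex.I) • v + u := by
        push_cast
        module
      rw [h2, map_add, map_smul] at h
      simp only [_root_.sub_apply, _root_.smul_apply,
        ContinuousLinearMap.comp_apply]
      rw [sub_eq_iff_eq_add]
      exact h.symm
    have hK0 : 0 ≤ K := (norm_nonneg _).trans (hK s hs).1
    rw [dist_eq_norm, e, norm_smul, Real.coe_toNNReal _ (mul_nonneg hK0 hK0), mul_comm,
      dist_comm s t, Real.dist_eq]
    have h1 : ‖((t - s : ℝ) * Complex.I : ℂ)‖ = |t - s| := by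
      rw [norm_mul, Complex.norm_I, mul_one, Complex.norm_real, Real.norm_eq_abs]
    rw [h1]
    refine mul_le_mul_of_nonneg_right ?_ (abs_nonneg _)
    exact (ContinuousLinearMap.opNorm_comp_le _ _).trans
      (mul_le_mul (hK t ht).1 (hK s hs).1 (norm_nonneg _) hK0)
  exact (LipschitzOnWith.of_dist_le_mul key).continuousOn

/-! ### The square root -/

/-- The contour integral for `√z / (1 + z)` converges absolutely along the rays `r ζ`,
`ζ = ± i`. -/
lemma HasImagResolventBound.integrableOn {T : H →ₗ.[ℂ] H} (hT : HasImagResolventBound T)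
    {ζ : ℂ} {s : ℝ} (hs : |s| = 1) (hζ : ζ = s * Complex.I) :
    IntegrableOn (fun r : ℝ => ((r * ζ) ^ (1 / 2 : ℂ) / (1 + r * ζ) * ζ) • resolventOp T (r * ζ))
      (Ioi 0) := by
  obtain ⟨K, hK⟩ := hT.exists_bound
  have hs0 : s ≠ 0 := by rintro rfl; simp at hs
  have hK0 : 0 ≤ K := (norm_nonneg _).trans (hK 1 one_ne_zero).1
  have hrζ : ∀ r : ℝ, r * ζ = (r * s : ℝ) * Complex.I := fun r => by rw [hζ]; push_cast; ring
  have hnζ : ‖ζ‖ = 1 := by simp [hζ, hs]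
  have hslit : ∀ r ∈ Ioi (0 : ℝ), (r * ζ : ℂ) ∈ Complex.slitPlane := by
    intro r hr
    rw [hrζ, Complex.mem_slitPlane_iff]
    right
    simpa using ⟨(mem_Ioi.mp hr).ne', hs0⟩
  have hone : ∀ r : ℝ, (1 : ℝ) ≤ ‖1 + r * ζ‖ := by
    intro r
    have := Complex.abs_re_le_norm (1 + r * ζ)
    rw [hrζ] at this ⊢
    simpa using this
  have hr : ∀ r : ℝ, r ≤ ‖1 + r * ζ‖ := by
    intro r
    have := Complex.abs_im_le_norm (1 + r * ζ)
    rw [hrζ] at this ⊢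
    simp only [Complex.add_im, Complex.one_im, Complex.mul_im, Complex.ofReal_re, Complex.I_im,
      Complex.ofReal_im, Complex.I_re, mul_one, mul_zero, add_zero, zero_add, abs_mul, hs] at this
    exact (le_abs_self r).trans this
  have hcont : ContinuousOn (fun r : ℝ => ((r * ζ) ^ (1 / 2 : ℂ) / (1 + r * ζ) * ζ) •
      resolventOp T (r * ζ)) (Ioi 0) := by
    have h1 : ContinuousOn (fun r : ℝ => (r * ζ : ℂ)) (Ioi 0) := by fun_prop
    have h2 : ContinuousOn (fun r : ℝ => (1 + r * ζ : ℂ)) (Ioi 0) := by fun_prop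
    refine ContinuousOn.smul
      (((h1.cpow_const (b := (1 / 2 : ℂ)) hslit).div h2 ?_).mul continuousOn_const) ?_
    · intro r _ h
      have := hone r
      rw [h, norm_zero] at this
      linarith
    · simp only [hrζ]
      refine hT.continuousOn.comp (f := fun r : ℝ => r * s) (by fun_prop) fun r hr => ?_
      exact mul_ne_zero (mem_Ioi.mp hr).ne' hs0
  have hmeas := hcont.aestronglyMeasurable measurableSet_Ioi (μ := volume)
  have hcpow : ∀ r ∈ Ioi (0 : ℝ), ‖(r * ζ) ^ (1 / 2 : ℂ)‖ = r ^ (1 / 2 : ℝ) := by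
    intro r hr
    have h2 : (1 / 2 : ℂ) = ((1 / 2 : ℝ) : ℂ) := by norm_num
    rw [h2, Complex.norm_cpow_real, norm_mul, hnζ, mul_one, Complex.norm_real, Real.norm_eq_abs,
      abs_of_pos (mem_Ioi.mp hr)]
  have hnorm : ∀ r ∈ Ioi (0 : ℝ), ‖((r * ζ) ^ (1 / 2 : ℂ) / (1 + r * ζ) * ζ) •
      resolventOp T (r * ζ)‖ = r ^ (1 / 2 : ℝ) / ‖1 + r * ζ‖ * ‖resolventOp T (r * ζ)‖ := by
    intro r hr
    rw [norm_smul, norm_mul, hnζ, mul_one, norm_div, hcpow r hr]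
  have hKr : ∀ r ∈ Ioi (0 : ℝ), ‖resolventOp T (r * ζ)‖ ≤ K ∧
      r * ‖resolventOp T (r * ζ)‖ ≤ K := by
    intro r hr
    have := hK (r * s) (mul_ne_zero (mem_Ioi.mp hr).ne' hs0)
    rwa [abs_mul, hs, mul_one, abs_of_pos (mem_Ioi.mp hr), ← hrζ] at this
  rw [← Ioc_union_Ioi_eq_Ioi zero_le_one]
  refine IntegrableOn.union ?_ ?_
  · -- Near `0` the integrand is bounded.
    refine Integrable.mono' (g := fun _ => K) (integrableOn_const (by simp))
      (hmeas.mono_set Ioc_subset_Ioi_self) ?_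
    refine (ae_restrict_mem measurableSet_Ioc).mono fun r hr' => ?_
    rw [hnorm r hr'.1]
    have h1 : r ^ (1 / 2 : ℝ) / ‖1 + r * ζ‖ ≤ 1 :=
      div_le_one_of_le₀ ((Real.rpow_le_one hr'.1.le hr'.2 (by norm_num)).trans (hone r))
        (norm_nonneg _)
    exact (mul_le_of_le_one_left (norm_nonneg _) h1).trans (hKr r hr'.1).1
  · -- Near infinity it decays like `r ^ (-3/2)`.
    refine Integrable.mono' (g := fun r => K * r ^ (-(3 / 2) : ℝ))
      ((integrableOn_Ioi_rpow_of_lt (by norm_num) one_pos).const_mul K)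
      (hmeas.mono_set (Ioi_subset_Ioi zero_le_one)) ?_
    refine (ae_restrict_mem measurableSet_Ioi).mono fun r hr' => ?_
    have hr0 : 0 < r := one_pos.trans hr'
    rw [hnorm r hr0]
    have h1 : r ^ (1 / 2 : ℝ) / ‖1 + r * ζ‖ ≤ r ^ (1 / 2 : ℝ) / r :=
      div_le_div_of_nonneg_left (by positivity) hr0 (hr r)
    have h2 : ‖resolventOp T (r * ζ)‖ ≤ K / r := by
      rw [le_div_iff₀ hr0, mul_comm]
      exact (hKr r hr0).2
    have h3 : r ^ (-(3 / 2) : ℝ) = r ^ (1 / 2 : ℝ) / r / r := by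
      rw [← Real.rpow_sub_one hr0.ne', ← Real.rpow_sub_one hr0.ne']
      norm_num
    rw [h3]
    calc _ ≤ r ^ (1 / 2 : ℝ) / r * (K / r) := by gcongr
      _ = _ := by ring

/-- The regularized square root `(√z / (1 + z))(T)`. -/
abbrev regSqrt (T : H →ₗ.[ℂ] H) : H →L[ℂ] H :=
  sectorIntegral T (Real.pi / 2) fun z => z ^ (1 / 2 : ℂ) / (1 + z)

lemma mem_graph_sqrtOp {T : H →ₗ.[ℂ] H} {u f : H} :
    (u, f) ∈ (sqrtOp T).graph ↔ (regSqrt T u, f - regSqrt T u) ∈ T.graph := by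
  rw [mem_graph_iff_exists,
    mem_graph_iff_exists]
  refine exists_congr fun h => ?_
  change regSqrt T u + T ⟨regSqrt T u, h⟩ = f ↔ _
  rw [eq_sub_iff_add_eq, add_comm]

variable [CompleteSpace H] [CompleteSpace H']

lemma regSqrt_intertwine {T : H →ₗ.[ℂ] H} {T' : H' →ₗ.[ℂ] H'} (hT : HasImagResolventBound T)
    (hT' : HasImagResolventBound T') (S : H →L[ℂ] H')
    (hS : ∀ u f, (u, f) ∈ T.graph → (S u, S f) ∈ T'.graph) :
    S ∘L regSqrt T = regSqrt T' ∘L S := by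
  have hray : ∀ (ζ : ℂ) (s : ℝ), |s| = 1 → ζ = s * Complex.I →
      S ∘L (∫ r in Ioi (0 : ℝ), ((r * ζ) ^ (1 / 2 : ℂ) / (1 + r * ζ) * ζ) • resolventOp T (r * ζ))
        = (∫ r in Ioi (0 : ℝ), ((r * ζ) ^ (1 / 2 : ℂ) / (1 + r * ζ) * ζ) •
          resolventOp T' (r * ζ)) ∘L S := by
    intro ζ s hs hζ
    have h1 := (ContinuousLinearMap.compL ℂ H H H' S).integral_comp_comm (hT.integrableOn hs hζ)
    have h2 := ((ContinuousLinearMap.compL ℂ H H' H').flip S).integral_comp_comm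
      (hT'.integrableOn hs hζ)
    simp only [ContinuousLinearMap.compL_apply, ContinuousLinearMap.flip_apply] at h1 h2
    rw [← h1, ← h2]
    refine setIntegral_congr_fun measurableSet_Ioi fun r hr => ?_
    have hs0 : s ≠ 0 := by rintro rfl; simp at hs
    have hrζ : r * ζ = (r * s : ℝ) * Complex.I := by rw [hζ]; push_cast; ring
    have hne : r * s ≠ 0 := mul_ne_zero (mem_Ioi.mp hr).ne' hs0
    have h := (hT.isResolvent hne).intertwine (hT'.isResolvent hne) S hS
    rw [← hrζ] at h
    simp only [ContinuousLinearMap.comp_smul, ContinuousLinearMap.smul_comp, h]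
  have hplus : Complex.exp (((Real.pi / 2 : ℝ) : ℂ) * Complex.I) = (1 : ℝ) * Complex.I := by
    push_cast
    rw [Complex.exp_pi_div_two_mul_I, one_mul]
  have hminus : Complex.exp (-(((Real.pi / 2 : ℝ) : ℂ) * Complex.I)) = (-1 : ℝ) * Complex.I := by
    rw [Complex.exp_neg, hplus]
    simp
  simp only [regSqrt, sectorIntegral, ContinuousLinearMap.comp_smul, ContinuousLinearMap.smul_comp,
    ContinuousLinearMap.comp_sub, ContinuousLinearMap.sub_comp]
  rw [hray _ 1 (by simp) hplus, hray _ (-1) (by simp) hminus]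

lemma mem_graph_sqrtOp_of_intertwine {T : H →ₗ.[ℂ] H} {T' : H' →ₗ.[ℂ] H'}
    (hT : HasImagResolventBound T) (hT' : HasImagResolventBound T') (S : H →L[ℂ] H')
    (hS : ∀ u f, (u, f) ∈ T.graph → (S u, S f) ∈ T'.graph) {u f : H}
    (h : (u, f) ∈ (sqrtOp T).graph) : (S u, S f) ∈ (sqrtOp T').graph := by
  have e : S (regSqrt T u) = regSqrt T' (S u) :=
    DFunLike.congr_fun (regSqrt_intertwine hT hT' S hS) u
  rw [mem_graph_sqrtOp] at h ⊢
  rw [← e, ← map_sub]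
  exact hS _ _ h

/-- The square root of an operator that splits along jointly injective `R i` splits in the same
way. -/
lemma mem_graph_sqrtOp_of_forall {ι : Type*} {G : ι → Type*} [∀ i, NormedAddCommGroup (G i)]
    [∀ i, InnerProductSpace ℂ (G i)] [∀ i, CompleteSpace (G i)] {T : H →ₗ.[ℂ] H}
    {T' : ∀ i, G i →ₗ.[ℂ] G i} (hT : HasImagResolventBound T)
    (hT' : ∀ i, HasImagResolventBound (T' i)) (R : ∀ i, H →L[ℂ] G i)
    (hR : ∀ i u f, (u, f) ∈ T.graph → (R i u, R i f) ∈ (T' i).graph)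
    (hinj : ∀ u, (∀ i, R i u = 0) → u = 0) {u f : H}
    (h : ∀ i, (R i u, R i f) ∈ (sqrtOp (T' i)).graph) : (u, f) ∈ (sqrtOp T).graph := by
  -- Membership in the graph of `T` is an equation for the resolvent at `i`, which can be checked
  -- after applying each `R i`.
  rw [mem_graph_sqrtOp, (hT.isResolvent one_ne_zero).mem_graph_iff, ← sub_eq_zero]
  refine hinj _ fun i => ?_
  have h1 := (hT.isResolvent one_ne_zero).intertwine ((hT' i).isResolvent one_ne_zero) (R i) (hR i)
  have h2 := regSqrt_intertwine hT (hT' i) (R i) (hR i)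
  have h3 := ((hT' i).isResolvent one_ne_zero).mem_graph_iff.mp (mem_graph_sqrtOp.mp (h i))
  have h1' := fun v => DFunLike.congr_fun h1 v
  have h2' := fun v => DFunLike.congr_fun h2 v
  simp only [ContinuousLinearMap.comp_apply] at h1' h2'
  rw [map_sub, h1', map_sub (R i), map_smul (R i), map_sub (R i), h2', h3, sub_self]

end Resolvent

/-! ### The square root property and Hilbert sums -/

section AbstractKato

/-- The square root property of `T` with form domain `V`, embedded by `J`: the graph of `√T` lies
over the range of `J`, and `C₁ ‖w‖ ≤ ‖√T (J w)‖ ≤ C₂ ‖w‖`. -/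
def AbstractKato {V H : Type*} [NormedAddCommGroup V] [NormedAddCommGroup H]
    [InnerProductSpace ℂ H] (T : H →ₗ.[ℂ] H) (J : V → H) (C₁ C₂ : ℝ) : Prop :=
  (∀ u f, (u, f) ∈ (sqrtOp T).graph → ∃ w, J w = u) ∧
    (∀ w, ∃ f, (J w, f) ∈ (sqrtOp T).graph) ∧
    ∀ w f, (J w, f) ∈ (sqrtOp T).graph → C₁ * ‖w‖ ≤ ‖f‖ ∧ ‖f‖ ≤ C₂ * ‖w‖

variable {ι H V : Type*} {G W : ι → Type*} [NormedAddCommGroup H] [InnerProductSpace ℂ H]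
  [CompleteSpace H] [∀ i, NormedAddCommGroup (G i)] [∀ i, InnerProductSpace ℂ (G i)]
  [∀ i, CompleteSpace (G i)] [NormedAddCommGroup V] [InnerProductSpace ℂ V]
  [CompleteSpace V] [∀ i, NormedAddCommGroup (W i)] [∀ i, InnerProductSpace ℂ (W i)]

/-- If both the Hilbert space and the form domain split as Hilbert sums, compatibly with the
embeddings `J`, `J' i` and with the operators, then the square root property for the sum is
equivalent to the one for all summands with the same constants. -/
theorem abstractKato_iff_forall
    {T : H →ₗ.[ℂ] H} {T' : ∀ i, G i →ₗ.[ℂ] G i} (hT : HasImagResolventBound T)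
    (hT' : ∀ i, HasImagResolventBound (T' i))
    {J : V → H} {J' : ∀ i, W i → G i}
    {E : ∀ i, G i →ₗᵢ[ℂ] H} {R : ∀ i, H →L[ℂ] G i} {F : ∀ i, W i →ₗᵢ[ℂ] V} {S : ∀ i, V → W i}
    (hE : IsHilbertSum ℂ G E) (hER : ∀ i x u, inner ℂ (E i x) u = inner ℂ x (R i u))
    (hF : IsHilbertSum ℂ W F) (hFS : ∀ i x u, inner ℂ (F i x) u = inner ℂ x (S i u))
    (hinj : ∀ u, (∀ i, R i u = 0) → u = 0)
    (hRE : ∀ i x, R i (E i x) = x)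
    (hJF : ∀ i x, J (F i x) = E i (J' i x)) (hJS : ∀ i w, J' i (S i w) = R i (J w))
    (hTR : ∀ i u f, (u, f) ∈ T.graph → (R i u, R i f) ∈ (T' i).graph)
    (hTE : ∀ i u f, (u, f) ∈ (T' i).graph → (E i u, E i f) ∈ T.graph)
    {C₁ C₂ : ℝ} (hC₁ : 0 < C₁) (hC₂ : 0 < C₂) :
    AbstractKato T J C₁ C₂ ↔ ∀ i, AbstractKato (T' i) (J' i) C₁ C₂ := by
  have hsR : ∀ i {u f}, (u, f) ∈ (sqrtOp T).graph → (R i u, R i f) ∈ (sqrtOp (T' i)).graph :=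
    fun i _ _ => mem_graph_sqrtOp_of_intertwine hT (hT' i) (R i) (hTR i)
  have hsE : ∀ i {u f}, (u, f) ∈ (sqrtOp (T' i)).graph → (E i u, E i f) ∈ (sqrtOp T).graph :=
    fun i _ _ => mem_graph_sqrtOp_of_intertwine (hT' i) hT (E i).toContinuousLinearMap (hTE i)
  constructor
  · rintro ⟨h1, h2, h3⟩ i
    refine ⟨fun u f huf => ?_, fun w => ?_, fun w f hwf => ?_⟩
    · obtain ⟨w, hw⟩ := h1 _ _ (hsE i huf)
      exact ⟨S i w, by rw [hJS, hw, hRE]⟩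
    · obtain ⟨f, hf⟩ := h2 (F i w)
      refine ⟨R i f, ?_⟩
      have h := hsR i hf
      rwa [hJF, hRE] at h
    · have h := hsE i hwf
      rw [← hJF] at h
      simpa using h3 _ _ h
  · intro h
    have hHsum := hasSum_norm_sq_of_isHilbertSum hE hER
    have hVsum := hasSum_norm_sq_of_isHilbertSum hF hFS
    have hbd : ∀ i w f, (J' i w, f) ∈ (sqrtOp (T' i)).graph →
        C₁ ^ 2 * ‖w‖ ^ 2 ≤ ‖f‖ ^ 2 ∧ ‖f‖ ^ 2 ≤ C₂ ^ 2 * ‖w‖ ^ 2 := by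
      intro i w f hwf
      obtain ⟨a, b⟩ := (h i).2.2 w f hwf
      rw [← mul_pow, ← mul_pow]
      exact ⟨pow_le_pow_left₀ (by positivity) a 2, pow_le_pow_left₀ (norm_nonneg _) b 2⟩
    refine ⟨fun u f huf => ?_, fun w => ?_, fun w f hwf => ?_⟩
    · -- The pieces of `u` are square summable in the form domains by the lower bound.
      choose w hw using fun i => (h i).1 _ _ (hsR i huf)
      have hsum : Summable fun i => ‖w i‖ ^ 2 := by
        refine Summable.of_nonneg_of_le (fun _ => by positivity) (fun i => ?_)
          ((hHsum f).summable.mul_left (C₁ ^ 2)⁻¹)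
        rw [inv_mul_eq_div, le_div_iff₀' (by positivity)]
        exact (hbd i (w i) _ ((hw i).symm ▸ hsR i huf)).1
      obtain ⟨v, hv⟩ := exists_of_summable_norm_sq hF hFS hsum
      refine ⟨v, sub_eq_zero.mp (hinj _ fun i => ?_)⟩
      rw [map_sub, ← hJS, hv, hw, sub_self]
    · -- The pieces of `√T (J w)` are square summable by the upper bound.
      choose f hf using fun i => (h i).2.1 (S i w)
      have hsum : Summable fun i => ‖f i‖ ^ 2 :=
        Summable.of_nonneg_of_le (fun _ => by positivity) (fun i => (hbd i _ _ (hf i)).2)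
          ((hVsum w).summable.mul_left (C₂ ^ 2))
      obtain ⟨g, hg⟩ := exists_of_summable_norm_sq hE hER hsum
      refine ⟨g, mem_graph_sqrtOp_of_forall hT hT' R hTR hinj fun i => ?_⟩
      rw [hg, ← hJS]
      exact hf i
    · have hi : ∀ i, (J' i (S i w), R i f) ∈ (sqrtOp (T' i)).graph := fun i => by
        rw [hJS]
        exact hsR i hwf
      have a := hasSum_le (fun i => (hbd i _ _ (hi i)).1) ((hVsum w).mul_left (C₁ ^ 2)) (hHsum f)
      have b := hasSum_le (fun i => (hbd i _ _ (hi i)).2) (hHsum f) ((hVsum w).mul_left (C₂ ^ 2))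
      rw [← mul_pow] at a b
      exact ⟨le_of_sq_le_sq a (norm_nonneg _), le_of_sq_le_sq b (by positivity)⟩

end AbstractKato

/-! ### Operators associated with coercive forms -/

section FormOperator

variable {V H : Type*} [NormedAddCommGroup V] [InnerProductSpace ℂ V] [CompleteSpace V]
  [NormedAddCommGroup H] [InnerProductSpace ℂ H] [CompleteSpace H]

/-- The Lax–Milgram lemma for `B - z J*J` with `z` imaginary: the added term does not change the
real part of the form. -/
lemma isUnit_sub_smul_adjoint_comp {B : V →L[ℂ] V} {l : ℝ} (hl : 0 < l)
    (hB : ∀ w, l * ‖w‖ ^ 2 ≤ (inner ℂ w (B w)).re) (J : V →L[ℂ] H) (t : ℝ) :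
    IsUnit (B - (t * Complex.I) • (J.adjoint ∘L J)) := by
  refine ContinuousLinearMap.isUnit_of_forall_le_norm_inner_map _ (c := ⟨l, hl.le⟩) hl fun w => ?_
  rw [mul_comm, norm_inner_symm]
  refine (hB w).trans (le_trans (le_of_eq ?_) (Complex.re_le_norm _))
  simp [inner_sub_right, inner_smul_right, ContinuousLinearMap.adjoint_inner_right,
    inner_self_eq_norm_sq_to_K, ← Complex.ofReal_pow]

/-- The sector estimate: if `B w = z J*J w - J* f` weakly with `z = i t`, the real part of the
tested equation controls `‖w‖`, and then the imaginary part controls `|t| ‖J w‖`. -/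
lemma norm_le_of_inner_sub_eq {V H : Type*} [NormedAddCommGroup V] [InnerProductSpace ℂ V]
    [NormedAddCommGroup H] [InnerProductSpace ℂ H] {B : V →L[ℂ] V} {l : ℝ} (hl : 0 < l)
    (hB : ∀ w, l * ‖w‖ ^ 2 ≤ (inner ℂ w (B w)).re) (J : V →L[ℂ] H) {t : ℝ} {w : V} {f : H}
    (hw : inner ℂ w (B w) - (t * Complex.I) * (‖J w‖ : ℂ) ^ 2 = - inner ℂ (J w) f) :
    ‖J w‖ ≤ ‖J‖ ^ 2 / l * ‖f‖ ∧ |t| * ‖J w‖ ≤ (‖B‖ / l + 1) * ‖f‖ := by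
  have hre : (inner ℂ w (B w)).re = - (inner ℂ (J w) f).re := by
    have := congrArg Complex.re hw
    simpa [← Complex.ofReal_pow] using this
  have him : t * ‖J w‖ ^ 2 = (inner ℂ w (B w)).im + (inner ℂ (J w) f).im := by
    have := congrArg Complex.im hw
    simp only [Complex.sub_im, Complex.mul_im, Complex.mul_re, Complex.ofReal_re, Complex.I_re,
      Complex.ofReal_im, Complex.I_im, Complex.neg_im, ← Complex.ofReal_pow] at this
    linarith
  have hin : ‖inner ℂ (J w) f‖ ≤ ‖J w‖ * ‖f‖ := norm_inner_le_norm _ _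
  have h1 : l * ‖w‖ ^ 2 ≤ ‖J w‖ * ‖f‖ := by
    refine (hB w).trans (hre.le.trans (le_trans ?_ hin))
    exact (neg_le_abs _).trans (Complex.abs_re_le_norm _)
  have hJ : ‖J w‖ ^ 2 ≤ ‖J‖ ^ 2 * ‖w‖ ^ 2 := by
    rw [← mul_pow]
    exact pow_le_pow_left₀ (norm_nonneg _) (J.le_opNorm w) 2
  have hBw : ‖inner ℂ w (B w)‖ ≤ ‖B‖ * ‖w‖ ^ 2 := by
    refine (norm_inner_le_norm _ _).trans ?_
    calc ‖w‖ * ‖B w‖ ≤ ‖w‖ * (‖B‖ * ‖w‖) := by gcongr; exact B.le_opNorm w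
      _ = _ := by ring
  have hw2 : ‖w‖ ^ 2 ≤ ‖J w‖ * ‖f‖ / l := (le_div_iff₀' hl).mpr h1
  rcases (norm_nonneg (J w)).eq_or_lt with h0 | h0
  · rw [← h0, mul_zero]
    exact ⟨by positivity, by positivity⟩
  refine ⟨le_of_mul_le_mul_left ?_ h0, le_of_mul_le_mul_left ?_ h0⟩
  · calc ‖J w‖ * ‖J w‖ ≤ ‖J‖ ^ 2 * ‖w‖ ^ 2 := by rwa [← sq]
      _ ≤ ‖J‖ ^ 2 * (‖J w‖ * ‖f‖ / l) := by gcongr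
      _ = _ := by ring
  · calc ‖J w‖ * (|t| * ‖J w‖) = |t * ‖J w‖ ^ 2| := by
          rw [abs_mul, abs_of_nonneg (sq_nonneg ‖J w‖)]; ring
      _ ≤ ‖inner ℂ w (B w)‖ + ‖inner ℂ (J w) f‖ := by
          rw [him]
          exact (abs_add_le _ _).trans
            (add_le_add (Complex.abs_im_le_norm _) (Complex.abs_im_le_norm _))
      _ ≤ ‖B‖ * (‖J w‖ * ‖f‖ / l) + ‖J w‖ * ‖f‖ :=
          add_le_add (hBw.trans (by gcongr)) hin
      _ = _ := by ring

/-- The operator associated with a bounded coercive form has the resolvent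
`(z - T)⁻¹ = - J (B - z J*J)⁻¹ J*` on the imaginary axis. -/
theorem hasImagResolventBound_of_form {T : H →ₗ.[ℂ] H} {B : V →L[ℂ] V} {l : ℝ} (hl : 0 < l)
    (hB : ∀ w, l * ‖w‖ ^ 2 ≤ (inner ℂ w (B w)).re) (J : V →L[ℂ] H)
    (hT : ∀ u f, (u, f) ∈ T.graph ↔
      ∃ w, J w = u ∧ ∀ v, inner ℂ v (B w) = inner ℂ (J v) f) : HasImagResolventBound T := by
  refine ⟨max (‖J‖ ^ 2 / l) (‖B‖ / l + 1), fun t _ => ?_⟩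
  obtain ⟨M, hM⟩ := isUnit_sub_smul_adjoint_comp hl hB J t
  have hMapp : ∀ w, (M : V →L[ℂ] V) w = B w - (t * Complex.I) • J.adjoint (J w) := fun w => by
    rw [hM]; rfl
  have hMinv : ∀ w, (M : V →L[ℂ] V) ((↑M⁻¹ : V →L[ℂ] V) w) = w := fun w =>
    DFunLike.congr_fun M.mul_inv w
  have hinvM : ∀ w, (↑M⁻¹ : V →L[ℂ] V) ((M : V →L[ℂ] V) w) = w := fun w =>
    DFunLike.congr_fun M.inv_mul w
  set R : H →L[ℂ] H := -(J ∘L (↑M⁻¹ : V →L[ℂ] V) ∘L J.adjoint) with hR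
  have hRapp : ∀ f, R f = J (-(↑M⁻¹ : V →L[ℂ] V) (J.adjoint f)) := fun f => by
    rw [map_neg]; rfl
  have hsolve : ∀ f, (M : V →L[ℂ] V) (-(↑M⁻¹ : V →L[ℂ] V) (J.adjoint f)) = - J.adjoint f :=
    fun f => by rw [map_neg, hMinv]
  have hbound : ∀ f, ‖R f‖ ≤ ‖J‖ ^ 2 / l * ‖f‖ ∧ |t| * ‖R f‖ ≤ (‖B‖ / l + 1) * ‖f‖ := by
    intro f
    rw [hRapp]
    refine norm_le_of_inner_sub_eq hl hB J ?_
    have h := hsolve f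
    rw [hMapp] at h
    generalize -(↑M⁻¹ : V →L[ℂ] V) (J.adjoint f) = w at h ⊢
    have h' := congrArg (inner ℂ w) h
    rw [inner_sub_right, inner_smul_right, inner_neg_right, J.adjoint_inner_right,
      J.adjoint_inner_right, inner_self_eq_norm_sq_to_K] at h'
    exact h'
  refine ⟨R, ⟨fun f => ?_, fun u => ?_⟩, ?_, ?_⟩
  · have hg : (R f, (t * Complex.I) • R f - f) ∈ T.graph := by
      refine (hT _ _).mpr ⟨_, (hRapp f).symm, fun v => ?_⟩
      have h := hsolve f
      rw [hMapp, ← hRapp, sub_eq_iff_eq_add] at h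
      rw [h, ← J.adjoint_inner_right, map_sub, map_smul]
      congr 1
      abel
    obtain ⟨h, h'⟩ := mem_graph_iff_exists.mp hg
    exact ⟨h, by rw [h', sub_sub_cancel]⟩
  · obtain ⟨w, hw, h⟩ := (hT _ _).mp (mem_graph_iff_exists.mpr ⟨u.2, rfl⟩)
    have hBw : B w = J.adjoint (T u) := ext_inner_left ℂ fun v => by
      rw [h, J.adjoint_inner_right]
    rw [hRapp, map_sub, map_smul, ← hBw, ← hw, ← neg_sub (B w), ← hMapp, map_neg, map_neg,
      hinvM, map_neg, neg_neg]
  · refine ContinuousLinearMap.opNorm_le_bound _ (le_max_of_le_left (by positivity)) fun f => ?_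
    exact (hbound f).1.trans (mul_le_mul_of_nonneg_right (le_max_left _ _) (norm_nonneg _))
  · have h : ‖((t : ℂ)) • R‖ ≤ max (‖J‖ ^ 2 / l) (‖B‖ / l + 1) := by
      refine ContinuousLinearMap.opNorm_le_bound _ (le_max_of_le_left (by positivity)) fun f => ?_
      rw [_root_.smul_apply, norm_smul, Complex.norm_real, Real.norm_eq_abs]
      exact (hbound f).2.trans (mul_le_mul_of_nonneg_right (le_max_right _ _) (norm_nonneg _))
    rwa [norm_smul, Complex.norm_real, Real.norm_eq_abs] at h

end FormOperator

variable {d m : ℕ} {O P Q : Set (Rd d)}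

/-! ### Restriction and extension by zero on `L²` -/

lemma inner_L2 (u v : L2 O m) : inner ℂ u v = ∫ x in O, inner ℂ (u x) (v x) := rfl

/-- Restriction `L²(O)^m → L²(P)^m` for `P ⊆ O`. -/
def resL2 (m : ℕ) (h : P ⊆ O) : L2 O m →L[ℂ] L2 P m :=
  LinearMap.mkContinuous
    { toFun := fun u => ((Lp.memLp u).mono_measure (Measure.restrict_mono h le_rfl)).toLp
      map_add' := fun u v => by
        rw [← MemLp.toLp_add]
        exact MemLp.toLp_congr _ _ (ae_mono (Measure.restrict_mono h le_rfl) (Lp.coeFn_add u v))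
      map_smul' := fun k u => by
        rw [RingHom.id_apply, ← MemLp.toLp_const_smul]
        exact MemLp.toLp_congr _ _
          (ae_mono (Measure.restrict_mono h le_rfl) (Lp.coeFn_smul k u)) } 1 fun u => by
    rw [one_mul, LinearMap.coe_mk, AddHom.coe_mk, Lp.norm_toLp, Lp.norm_def]
    exact ENNReal.toReal_mono (Lp.eLpNorm_ne_top u)
      (eLpNorm_mono_measure _ (Measure.restrict_mono h le_rfl))

lemma coeFn_resL2 (h : P ⊆ O) (u : L2 O m) : resL2 m h u =ᵐ[volume.restrict P] u :=
  MemLp.coeFn_toLp ((Lp.memLp u).mono_measure (Measure.restrict_mono h le_rfl))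

lemma memLp_indicator_L2 (hP : MeasurableSet P) (h : P ⊆ O) (u : L2 P m) :
    MemLp (P.indicator u) 2 (volume.restrict O) := by
  rw [memLp_indicator_iff_restrict hP, Measure.restrict_restrict hP, inter_eq_self_of_subset_left h]
  exact Lp.memLp u

/-- Almost everywhere equality on `P` gives it on `O` for the extensions by zero. -/
lemma indicator_ae_eq {β : Type*} [Zero β] (hP : MeasurableSet P) {f g : Rd d → β}
    (hfg : f =ᵐ[volume.restrict P] g) :
    P.indicator f =ᵐ[volume.restrict O] P.indicator g := by
  refine ae_restrict_of_ae ?_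
  filter_upwards [(ae_restrict_iff' hP).mp hfg] with x hx
  by_cases hxP : x ∈ P
  · simp [hxP, hx hxP]
  · simp [hxP]

/-- Extension by zero, `L²(P)^m → L²(O)^m`, as a linear map. -/
def extL2Aux (m : ℕ) (hP : MeasurableSet P) (h : P ⊆ O) : L2 P m →ₗ[ℂ] L2 O m where
  toFun u := (memLp_indicator_L2 hP h u).toLp
  map_add' u v := by
    rw [← MemLp.toLp_add]
    refine MemLp.toLp_congr _ _ ?_
    rw [← indicator_add']
    exact indicator_ae_eq hP (Lp.coeFn_add u v)
  map_smul' k u := by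
    rw [RingHom.id_apply, ← MemLp.toLp_const_smul]
    refine MemLp.toLp_congr _ _ ?_
    exact (indicator_ae_eq hP (Lp.coeFn_smul k u)).trans (.of_eq (indicator_const_smul P k u))

lemma coeFn_extL2Aux (hP : MeasurableSet P) (h : P ⊆ O) (u : L2 P m) :
    extL2Aux m hP h u =ᵐ[volume.restrict O] P.indicator u :=
  MemLp.coeFn_toLp (memLp_indicator_L2 hP h u)

lemma setIntegral_eq_of_indicator {F : Type*} [NormedAddCommGroup F] [NormedSpace ℝ F]
    (hP : MeasurableSet P) (h : P ⊆ O) {f g : Rd d → F}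
    (hf : f =ᵐ[volume.restrict O] P.indicator g) : ∫ x in O, f x = ∫ x in P, g x := by
  rw [integral_congr_ae hf, setIntegral_indicator hP, inter_eq_self_of_subset_right h]

lemma inner_extL2Aux (hP : MeasurableSet P) (h : P ⊆ O) (u : L2 P m) (v : L2 O m) :
    inner ℂ (extL2Aux m hP h u) v = inner ℂ u (resL2 m h v) := by
  rw [inner_L2, inner_L2, setIntegral_eq_of_indicator hP h (g := fun x => inner ℂ (u x) (v x))]
  · refine integral_congr_ae ?_
    filter_upwards [coeFn_resL2 h v] with x hx
    rw [hx]
  · filter_upwards [coeFn_extL2Aux hP h u] with x hx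
    by_cases hxP : x ∈ P <;> simp [hx, hxP]

lemma resL2_extL2Aux (hP : MeasurableSet P) (h : P ⊆ O) (u : L2 P m) :
    resL2 m h (extL2Aux m hP h u) = u := by
  refine Lp.ext ?_
  filter_upwards [coeFn_resL2 h (extL2Aux m hP h u),
    ae_mono (Measure.restrict_mono h le_rfl) (coeFn_extL2Aux hP h u),
    ae_restrict_mem hP] with x h1 h2 h3
  rw [h1, h2, indicator_of_mem h3]

/-- A linear map which has an adjoint as left inverse is isometric. -/
lemma norm_map_of_inner_of_leftInverse {V W : Type*} [NormedAddCommGroup V]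
    [InnerProductSpace ℂ V] [NormedAddCommGroup W] [InnerProductSpace ℂ W] {E : V → W} {R : W → V}
    (hER : ∀ x y, inner ℂ (E x) y = inner ℂ x (R y)) (hRE : ∀ x, R (E x) = x) (x : V) :
    ‖E x‖ = ‖x‖ := by
  rw [norm_eq_sqrt_re_inner (𝕜 := ℂ), hER, hRE, ← norm_eq_sqrt_re_inner]

/-- Extension by zero, `L²(P)^m → L²(O)^m`, as a linear isometry. -/
def extL2 (m : ℕ) (hP : MeasurableSet P) (h : P ⊆ O) : L2 P m →ₗᵢ[ℂ] L2 O m where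
  toLinearMap := extL2Aux m hP h
  norm_map' := norm_map_of_inner_of_leftInverse (inner_extL2Aux hP h) (resL2_extL2Aux hP h)

lemma coeFn_extL2 (hP : MeasurableSet P) (h : P ⊆ O) (u : L2 P m) :
    extL2 m hP h u =ᵐ[volume.restrict O] P.indicator u := coeFn_extL2Aux hP h u

lemma inner_extL2 (hP : MeasurableSet P) (h : P ⊆ O) (u : L2 P m) (v : L2 O m) :
    inner ℂ (extL2 m hP h u) v = inner ℂ u (resL2 m h v) := inner_extL2Aux hP h u v

lemma resL2_extL2 (hP : MeasurableSet P) (h : P ⊆ O) (u : L2 P m) :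
    resL2 m h (extL2 m hP h u) = u := resL2_extL2Aux hP h u

lemma resL2_extL2_of_disjoint (hP : MeasurableSet P) (h : P ⊆ O) (hQ : MeasurableSet Q)
    (hQO : Q ⊆ O) (hPQ : Disjoint P Q) (u : L2 P m) : resL2 m hQO (extL2 m hP h u) = 0 := by
  refine Lp.ext ?_
  filter_upwards [coeFn_resL2 hQO (extL2 m hP h u), Lp.coeFn_zero (Cm m) 2 (volume.restrict Q),
    ae_mono (Measure.restrict_mono hQO le_rfl) (coeFn_extL2 hP h u),
    ae_restrict_mem hQ] with x h1 h2 h3 h4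
  rw [h1, h2, h3, indicator_of_notMem (disjoint_right.mp hPQ h4), Pi.zero_apply]

/-- A union of open sets is a union of countably many of them, so an element of `L²(O)^m` is
determined by its restrictions to the pieces even if there are uncountably many. -/
lemma eq_zero_of_resL2_eq_zero {ι : Type*} {P : ι → Set (Rd d)} (hPopen : ∀ i, IsOpen (P i))
    (hPO : O = ⋃ i, P i) (hsub : ∀ i, P i ⊆ O) {u : L2 O m} (hu : ∀ i, resL2 m (hsub i) u = 0) :
    u = 0 := by
  obtain ⟨t, ht, htU⟩ := TopologicalSpace.isOpen_iUnion_countable P hPopen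
  have h : ∀ i, ∀ᵐ x, x ∈ P i → u x = 0 := fun i => by
    rw [← ae_restrict_iff' (hPopen i).measurableSet]
    filter_upwards [coeFn_resL2 (hsub i) u, Lp.coeFn_zero (Cm m) 2 (volume.restrict (P i))]
      with x h1 h2
    rw [← h1, hu, h2, Pi.zero_apply]
  rw [Lp.eq_zero_iff_ae_eq_zero, Filter.EventuallyEq,
    ae_restrict_iff' (hPO ▸ isOpen_iUnion hPopen).measurableSet]
  filter_upwards [(ae_ball_iff ht).mpr fun i _ => h i] with x hx hxO
  rw [hPO, ← htU] at hxO
  obtain ⟨i, hi, hxi⟩ := mem_iUnion₂.mp hxO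
  exact hx i hi hxi

/-! ### Test functions as elements of `L²` -/

/-- The element `φ e` of `L²(O)^m`, for a continuous scalar `φ` with compact support and a fixed
vector `e`. -/
def testL2 (O : Set (Rd d)) {φ : Rd d → ℝ} (hφ : Continuous φ) (hc : HasCompactSupport φ)
    (e : Cm m) : L2 O m :=
  ((show Continuous fun x => φ x • e by fun_prop).memLp_of_hasCompactSupport
    (hc.smul_right (f' := fun _ => e)) (p := 2) (μ := volume.restrict O)).toLp

lemma coeFn_testL2 {φ : Rd d → ℝ} (hφ : Continuous φ) (hc : HasCompactSupport φ) (e : Cm m) :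
    testL2 O hφ hc e =ᵐ[volume.restrict O] fun x => φ x • e :=
  MemLp.coeFn_toLp _

lemma inner_testL2 {φ : Rd d → ℝ} (hφ : Continuous φ) (hc : HasCompactSupport φ) (e : Cm m)
    (u : L2 O m) : inner ℂ (testL2 O hφ hc e) u = inner ℂ e (∫ x in O, φ x • u x) := by
  rw [← integral_inner (integrable_smul_L2 φ hφ hc u), inner_L2]
  refine integral_congr_ae ?_
  filter_upwards [coeFn_testL2 hφ hc e] with x hx
  rw [hx, ← Complex.coe_smul, ← Complex.coe_smul, inner_smul_left, inner_smul_right,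
    Complex.conj_ofReal]

lemma eq_zero_of_forall_integral_smul_eq_zero (hO : IsOpen O) {u : L2 O m}
    (h : ∀ φ : Rd d → ℝ, ContDiff ℝ ∞ φ → HasCompactSupport φ → tsupport φ ⊆ O →
      ∫ x in O, φ x • u x = 0) : u = 0 := by
  rw [Lp.eq_zero_iff_ae_eq_zero, Filter.EventuallyEq, ae_restrict_iff' hO.measurableSet]
  refine hO.ae_eq_zero_of_integral_contDiff_smul_eq_zero ?_ fun φ h1 h2 h3 => ?_
  · exact locallyIntegrableOn_of_locallyIntegrable_restrict
      ((Lp.memLp u).locallyIntegrable (by norm_num))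
  · rw [← h φ h1 h2 h3]
    refine (setIntegral_eq_integral_of_forall_compl_eq_zero fun x hx => ?_).symm
    rw [image_eq_zero_of_notMem_tsupport fun hx' => hx (h3 hx'), zero_smul]

/-- The defining identity of a weak derivative, tested in `L²`. -/
lemma isWeakPartial_iff_inner {i : Fin d} {u g : L2 O m} :
    IsWeakPartial O i u g ↔ ∀ (φ : Rd d → ℝ) (h1 : ContDiff ℝ ∞ φ) (h2 : HasCompactSupport φ),
      tsupport φ ⊆ O → ∀ e : Cm m,
        inner ℂ (testL2 O (continuous_partialDeriv i h1) (hasCompactSupport_partialDeriv i h2) e) u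
          = - inner ℂ (testL2 O h1.continuous h2 e) g := by
  simp only [inner_testL2, ← inner_neg_right]
  exact ⟨fun h φ h1 h2 h3 e => by rw [h φ h1 h2 h3],
    fun h φ h1 h2 h3 => ext_inner_left ℂ (h φ h1 h2 h3)⟩

lemma integral_partialDeriv_mul (i : Fin d) {φ ψ : Rd d → ℝ} (hφ : ContDiff ℝ ∞ φ)
    (hψ : ContDiff ℝ ∞ ψ) (hc : HasCompactSupport φ) :
    ∫ x, partialDeriv i ψ x * φ x = - ∫ x, ψ x * partialDeriv i φ x := by
  have h := integral_mul_fderiv_eq_neg_fderiv_mul_of_integrable (μ := volume) (f := ψ) (g := φ)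
    (v := EuclideanSpace.single i 1)
    (((continuous_partialDeriv i hψ).mul hφ.continuous).integrable_of_hasCompactSupport
      hc.mul_left)
    ((hψ.continuous.mul (continuous_partialDeriv i hφ)).integrable_of_hasCompactSupport
      (hasCompactSupport_partialDeriv i hc).mul_left)
    ((hψ.continuous.mul hφ.continuous).integrable_of_hasCompactSupport hc.mul_left)
    (fun x _ => hψ.differentiable (by simp) x) (fun x _ => hφ.differentiable (by simp) x)
  exact neg_eq_iff_eq_neg.mp h.symm

lemma isWeakPartial_testL2 (i : Fin d) {φ : Rd d → ℝ} (hφ : ContDiff ℝ ∞ φ)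
    (hc : HasCompactSupport φ) (e : Cm m) :
    IsWeakPartial O i (testL2 O hφ.continuous hc e)
      (testL2 O (continuous_partialDeriv i hφ) (hasCompactSupport_partialDeriv i hc) e) := by
  intro ψ h1 h2 h3
  have key : ∀ (η χ : Rd d → ℝ) (hχ : Continuous χ) (hχc : HasCompactSupport χ),
      (∀ x ∉ O, η x = 0) → ∫ x in O, η x • testL2 O hχ hχc e x = (∫ x, η x * χ x) • e := by
    intro η χ hχ hχc hη
    rw [← integral_smul_const, ← setIntegral_eq_integral_of_forall_compl_eq_zero (s := O)
      (f := fun x => (η x * χ x) • e) fun x hx => by simp [hη x hx]]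
    refine integral_congr_ae ?_
    filter_upwards [coeFn_testL2 hχ hχc e] with x hx
    rw [hx, smul_smul]
  have h0 : ∀ x ∉ O, x ∉ tsupport ψ := fun x hx hx' => hx (h3 hx')
  rw [key (partialDeriv i ψ) _ _ _ fun x hx => image_eq_zero_of_notMem_tsupport fun h =>
      h0 x hx (tsupport_fderiv_apply_subset ℝ _ h),
    key ψ _ _ _ fun x hx => image_eq_zero_of_notMem_tsupport (h0 x hx),
    integral_partialDeriv_mul i hφ h1 hc, neg_smul]

variable {D : Set (Rd d)}

/-! ### Sobolev functions -/

lemma norm_sq_W12 (w : W12 O m) :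
    ‖w‖ ^ 2 = ‖toL2 O m w‖ ^ 2 + ∑ i, ‖grad O m i w‖ ^ 2 := by
  change ‖(w : Jet O m)‖ ^ 2 = _
  rw [WithLp.prod_norm_sq_eq_of_L2, PiLp.norm_sq_eq_of_L2]
  rfl

lemma continuous_toL2 : Continuous (toL2 O m) :=
  (WithLp.continuous_fst 2 (L2 O m) (PiLp 2 fun _ : Fin d => L2 O m)).comp continuous_subtype_val

lemma continuous_jet_snd (i : Fin d) : Continuous fun w : Jet O m => w.snd i :=
  (PiLp.continuous_apply 2 (fun _ : Fin d => L2 O m) i).comp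
    (WithLp.continuous_snd 2 (L2 O m) (PiLp 2 fun _ : Fin d => L2 O m))

lemma continuous_grad (i : Fin d) : Continuous (grad O m i) :=
  (continuous_jet_snd i).comp continuous_subtype_val

lemma W12_ext {v w : W12 O m} (h : toL2 O m v = toL2 O m w)
    (h' : ∀ i, grad O m i v = grad O m i w) : v = w := by
  rw [← sub_eq_zero, ← norm_eq_zero, ← sq_eq_zero_iff, norm_sq_W12]
  simp [map_sub, h, h']

/-- Weak derivatives are unique. -/
lemma toL2_injective (hO : IsOpen O) : Function.Injective (toL2 O m) := by
  intro v w h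
  refine W12_ext h fun i => sub_eq_zero.mp (eq_zero_of_forall_integral_smul_eq_zero hO ?_)
  intro φ h1 h2 h3
  have h4 := (v - w).2 i φ h1 h2 h3
  have h5 : ((v - w : W12 O m) : Jet O m).fst = 0 := by
    change toL2 O m (v - w) = 0
    rw [map_sub, h, sub_self]
  have h6 : ∫ x in O, partialDeriv i φ x • (0 : L2 O m) x = 0 := by
    rw [← integral_zero (Rd d) (Cm m) (μ := volume.restrict O)]
    refine integral_congr_ae ?_
    filter_upwards [Lp.coeFn_zero (Cm m) 2 (volume.restrict O)] with x hx
    rw [hx, Pi.zero_apply, smul_zero]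
  rw [h5, h6] at h4
  exact neg_eq_zero.mp h4.symm

lemma isClosed_W12 : IsClosed (W12 O m : Set (Jet O m)) := by
  have h : (W12 O m : Set (Jet O m)) = {w | ∀ i, ∀ (φ : Rd d → ℝ) (h1 : ContDiff ℝ ∞ φ)
      (h2 : HasCompactSupport φ), tsupport φ ⊆ O → ∀ e : Cm m,
      inner ℂ (testL2 O (continuous_partialDeriv i h1) (hasCompactSupport_partialDeriv i h2) e)
        w.fst = - inner ℂ (testL2 O h1.continuous h2 e) (w.snd i)} := by
    ext w
    exact forall_congr' fun i => isWeakPartial_iff_inner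
  rw [h]
  simp only [ofPred_forall]
  refine isClosed_iInter fun i => isClosed_iInter fun φ => isClosed_iInter fun h1 =>
    isClosed_iInter fun h2 => isClosed_iInter fun _ => isClosed_iInter fun e => isClosed_eq ?_ ?_
  · exact continuous_const.inner
      (WithLp.continuous_fst 2 (L2 O m) (PiLp 2 fun _ : Fin d => L2 O m))
  · exact (continuous_const.inner (continuous_jet_snd i)).neg

/-- The element of `W^{1,2}(O)^m` with given weak gradient. -/
def mkW12 (u : L2 O m) (g : Fin d → L2 O m) (h : ∀ i, IsWeakPartial O i u (g i)) : W12 O m :=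
  ⟨WithLp.toLp 2 (u, WithLp.toLp 2 g), h⟩

lemma isWeakPartial_resL2 (hO : IsOpen O) (h : P ⊆ O) {i : Fin d} {u g : L2 O m}
    (hu : IsWeakPartial O i u g) : IsWeakPartial P i (resL2 m h u) (resL2 m h g) := by
  intro φ h1 h2 h3
  have key : ∀ (η : Rd d → ℝ) (v : L2 O m), (∀ x ∉ P, η x = 0) →
      ∫ x in P, η x • resL2 m h v x = ∫ x in O, η x • v x := by
    intro η v hη
    rw [setIntegral_eq_of_subset_of_forall_sdiff_eq_zero (s := P) hO.measurableSet h
      fun x hx => by rw [hη x hx.2, zero_smul]]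
    refine integral_congr_ae ?_
    filter_upwards [coeFn_resL2 h v] with x hx
    rw [hx]
  have h0 : ∀ x ∉ P, x ∉ tsupport φ := fun x hx hx' => hx (h3 hx')
  rw [key (partialDeriv i φ) _ fun x hx => image_eq_zero_of_notMem_tsupport fun hx' =>
      h0 x hx (tsupport_fderiv_apply_subset ℝ _ hx'),
    key φ _ fun x hx => image_eq_zero_of_notMem_tsupport (h0 x hx)]
  exact hu φ h1 h2 (h3.trans h)

/-- If `P` is open and relatively closed in `O`, then a test function in `O` cut off to `P` is a
test function in `P`. -/
lemma tsupport_indicator_subset (hcl : closure P ∩ O ⊆ P) {φ : Rd d → ℝ} (h : tsupport φ ⊆ O) :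
    tsupport (P.indicator φ) ⊆ P := by
  refine fun x hx => hcl ⟨?_, h ?_⟩
  · exact closure_mono (support_indicator_subset) hx
  · exact closure_mono (by rw [support_indicator]; exact inter_subset_right) hx

lemma contDiff_indicator (hP : IsOpen P) (hcl : closure P ∩ O ⊆ P) {φ : Rd d → ℝ}
    (hφ : ContDiff ℝ ∞ φ) (h : tsupport φ ⊆ O) : ContDiff ℝ ∞ (P.indicator φ) := by
  rw [contDiff_iff_contDiffAt]
  intro x
  by_cases hx : x ∈ P
  · refine hφ.contDiffAt.congr_of_eventuallyEq ?_
    filter_upwards [hP.mem_nhds hx] with y hy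
    exact indicator_of_mem hy _
  · have h' : x ∉ tsupport (P.indicator φ) := fun h' => hx (tsupport_indicator_subset hcl h h')
    exact (contDiffAt_const (c := (0 : ℝ))).congr_of_eventuallyEq
      (notMem_tsupport_iff_eventuallyEq.mp h')

lemma isWeakPartial_extL2 (hP : IsOpen P) (h : P ⊆ O) (hcl : closure P ∩ O ⊆ P) {i : Fin d}
    {u g : L2 P m} (hu : IsWeakPartial P i u g) :
    IsWeakPartial O i (extL2 m hP.measurableSet h u) (extL2 m hP.measurableSet h g) := by
  intro φ h1 h2 h3
  have key : ∀ (η ζ : Rd d → ℝ) (v : L2 P m), (∀ x ∈ P, η x = ζ x) →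
      ∫ x in O, η x • extL2 m hP.measurableSet h v x = ∫ x in P, ζ x • v x := by
    intro η ζ v hη
    refine setIntegral_eq_of_indicator hP.measurableSet h ?_
    filter_upwards [coeFn_extL2 hP.measurableSet h v] with x hx
    by_cases hxP : x ∈ P
    · simp [hx, hxP, hη x hxP]
    · simp [hx, hxP]
  rw [key (partialDeriv i φ) (partialDeriv i (P.indicator φ)) u fun x hx => ?_,
    key φ (P.indicator φ) g fun x hx => (indicator_of_mem hx φ).symm]
  · refine hu _ (contDiff_indicator hP hcl h1 h3) ?_ (tsupport_indicator_subset hcl h3)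
    exact h2.mono (by rw [support_indicator]; exact inter_subset_right)
  · have e : φ =ᶠ[nhds x] P.indicator φ := by
      filter_upwards [hP.mem_nhds hx] with y hy
      exact (indicator_of_mem hy _).symm
    simp only [partialDeriv, e.fderiv_eq]

/-- Restriction `W^{1,2}(O)^m → W^{1,2}(P)^m`. -/
def resW12 (m : ℕ) (hO : IsOpen O) (h : P ⊆ O) : W12 O m →ₗ[ℂ] W12 P m where
  toFun w := mkW12 (resL2 m h (toL2 O m w)) (fun i => resL2 m h (grad O m i w))
    fun i => isWeakPartial_resL2 hO h (w.2 i)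
  map_add' v w := W12_ext (map_add (resL2 m h) (toL2 O m v) (toL2 O m w))
    fun i => map_add (resL2 m h) (grad O m i v) (grad O m i w)
  map_smul' k w := W12_ext (map_smul (resL2 m h) k (toL2 O m w))
    fun i => map_smul (resL2 m h) k (grad O m i w)

/-- Extension by zero `W^{1,2}(P)^m → W^{1,2}(O)^m`, for `P` open and relatively closed in `O`. -/
def extW12 (m : ℕ) (hP : IsOpen P) (h : P ⊆ O) (hcl : closure P ∩ O ⊆ P) :
    W12 P m →ₗ[ℂ] W12 O m where
  toFun w := mkW12 (extL2 m hP.measurableSet h (toL2 P m w))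
    (fun i => extL2 m hP.measurableSet h (grad P m i w))
    fun i => isWeakPartial_extL2 hP h hcl (w.2 i)
  map_add' v w := W12_ext (map_add (extL2 m hP.measurableSet h) (toL2 P m v) (toL2 P m w))
    fun i => map_add (extL2 m hP.measurableSet h) (grad P m i v) (grad P m i w)
  map_smul' k w := W12_ext (map_smul (extL2 m hP.measurableSet h) k (toL2 P m w))
    fun i => map_smul (extL2 m hP.measurableSet h) k (grad P m i w)

section
variable (hO : IsOpen O) (hP : IsOpen P) (h : P ⊆ O) (hcl : closure P ∩ O ⊆ P)

lemma toL2_resW12 (w : W12 O m) : toL2 P m (resW12 m hO h w) = resL2 m h (toL2 O m w) := rfl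

lemma grad_resW12 (i : Fin d) (w : W12 O m) :
    grad P m i (resW12 m hO h w) = resL2 m h (grad O m i w) := rfl

lemma toL2_extW12 (w : W12 P m) :
    toL2 O m (extW12 m hP h hcl w) = extL2 m hP.measurableSet h (toL2 P m w) := rfl

lemma grad_extW12 (i : Fin d) (w : W12 P m) :
    grad O m i (extW12 m hP h hcl w) = extL2 m hP.measurableSet h (grad P m i w) := rfl

lemma norm_resL2_le (u : L2 O m) : ‖resL2 m h u‖ ≤ ‖u‖ := by
  refine (ContinuousLinearMap.le_of_opNorm_le _ (LinearMap.mkContinuous_norm_le _ zero_le_one _)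
    u).trans (one_mul _).le

lemma continuous_resW12 : Continuous (resW12 m hO h) := by
  refine AddMonoidHomClass.continuous_of_bound _ 1 fun w => ?_
  rw [one_mul, ← sq_le_sq₀ (norm_nonneg _) (norm_nonneg _), norm_sq_W12, norm_sq_W12]
  simp only [toL2_resW12, grad_resW12]
  gcongr <;> exact norm_resL2_le h _

lemma continuous_extW12 : Continuous (extW12 m hP h hcl) := by
  refine AddMonoidHomClass.continuous_of_bound _ 1 fun w => ?_
  rw [one_mul, ← sq_le_sq₀ (norm_nonneg _) (norm_nonneg _), norm_sq_W12, norm_sq_W12]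
  simp only [toL2_extW12, grad_extW12, LinearIsometry.norm_map, le_refl]

end

/-! ### Boundary conditions on the pieces -/

/-- A point of `∂P \ D` has positive distance from `O \ P`: nearby points of `P` and of `O \ P`
could otherwise be joined by a curve in `O`, although `P` is open and relatively closed in `O`. -/
lemma notMem_closure_diff (hP : IsOpen P) (h : P ⊆ O) (hcl : closure P ∩ O ⊆ P)
    (hunif : IsLocallyUniformNear O (frontier O \ D)) {z : Rd d} (hzP : z ∈ closure P)
    (hzO : z ∈ frontier O) (hzD : z ∉ D) : z ∉ closure (O \ P) := by
  intro hz
  obtain ⟨ε, δ, -, -, hδ, hjoin, -⟩ := hunif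
  have hδ2 : (0 : ℝ≥0∞) < δ / 2 := ENNReal.half_pos hδ.ne'
  have hnear : ∀ x, edist x z < δ / 2 → x ∈ nbhd (frontier O \ D) δ := fun x hx =>
    (Metric.infEDist_le_edist_of_mem (show z ∈ frontier O \ D from ⟨hzO, hzD⟩)).trans_lt
      (hx.trans_le ENNReal.half_le_self)
  obtain ⟨x, hxP, hx⟩ := EMetric.mem_closure_iff.mp hzP _ hδ2
  obtain ⟨y, hyP, hy⟩ := EMetric.mem_closure_iff.mp hz _ hδ2
  rw [edist_comm] at hx hy
  have hxy : edist x y < δ := by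
    refine (edist_triangle_right x y z).trans_lt ?_
    calc _ < δ / 2 + δ / 2 := ENNReal.add_lt_add hx hy
      _ = δ := ENNReal.add_halves δ
  obtain ⟨γ, hγ, h0, h1, hγO, -⟩ := hjoin x ⟨h hxP, hnear x hx⟩ y ⟨hyP.1, hnear y hy⟩ hxy
  have hsub : γ '' Icc 0 1 ⊆ P := by
    refine (isPreconnected_Icc.image γ hγ).subset_of_closure_inter_subset hP ?_ ?_
    · exact ⟨x, ⟨0, by simp, h0⟩, hxP⟩
    · rintro _ ⟨hw, t, ht, rfl⟩
      exact hcl ⟨hw, hγO t ht⟩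
  exact hyP.2 (h1 ▸ hsub ⟨1, by simp, rfl⟩)

lemma exists_dist_of_isCompact_of_disjoint {K : Set (Rd d)} (hK : IsCompact K) (hD : IsClosed D)
    (h : Disjoint K D) : ∃ r : ℝ, 0 < r ∧ ∀ x ∈ K, ∀ y ∈ D, r ≤ dist x y := by
  obtain ⟨r, hr, hr'⟩ := Metric.exists_pos_forall_lt_edist hK hD h
  refine ⟨r, hr, fun x hx y hy => ?_⟩
  have := hr' x hx y hy
  rw [edist_nndist, ENNReal.coe_lt_coe] at this
  exact_mod_cast this.le

lemma exists_contDiff_cutoff {F K : Set (Rd d)} (hF : IsClosed F) (hK : IsClosed K)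
    (h : Disjoint F K) : ∃ χ : Rd d → ℝ, ContDiff ℝ ∞ χ ∧ (∀ x ∈ F, x ∉ tsupport χ) ∧
      ∀ x ∈ K, χ x = 1 := by
  obtain ⟨χ, hχ0, hχ1, -⟩ := exists_contMDiffMap_zero_one_nhds_of_isClosed
    (modelWithCornersSelf ℝ (Rd d)) (n := ⊤) hF hK h
  exact ⟨χ, χ.contMDiff.contDiff, fun x hx =>
    notMem_tsupport_iff_eventuallyEq.mpr (hχ0.filter_mono (nhds_le_nhdsSet hx)),
    fun x hx => (hχ1.filter_mono (nhds_le_nhdsSet hx)).self_of_nhds⟩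

/-- A test function for the piece `P` agrees on `P` with a test function for `O` that vanishes on
`O \ P`: the part of its support in `closure P` does not meet the closed set
`closure (O \ P) ∪ D`, so that it can be cut off. -/
lemma exists_isTestFunction_of_piece (hO : IsOpen O) (hD : IsClosed D) (hDO : D ⊆ frontier O)
    (hP : IsOpen P) (h : P ⊆ O) (hcl : closure P ∩ O ⊆ P)
    (hunif : IsLocallyUniformNear O (frontier O \ D)) {φ : Rd d → Cm m}
    (hφ : IsTestFunction (D ∩ frontier P) φ) :
    ∃ ψ : Rd d → Cm m, IsTestFunction D ψ ∧ (∀ x ∈ P, ψ x = φ x) ∧ ∀ x ∈ O \ P, ψ x = 0 := by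
  obtain ⟨h1, h2, r, hr, h3⟩ := hφ
  have hK : IsCompact (tsupport φ ∩ closure P) := h2.isCompact.inter_right isClosed_closure
  have hF : IsClosed (closure (O \ P) ∪ D) := isClosed_closure.union hD
  have hdisj : Disjoint (closure (O \ P) ∪ D) (tsupport φ ∩ closure P) := by
    rw [disjoint_left]
    rintro z hz ⟨hzφ, hzP⟩
    have hzO : z ∉ O := by
      intro hzO
      have hzP' : z ∈ P := hcl ⟨hzP, hzO⟩
      rcases hz with hz | hz
      · obtain ⟨y, hyP, hy⟩ := mem_closure_iff.mp hz P hP hzP'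
        exact hy.2 hyP
      · exact disjoint_left.mp (disjoint_frontier_iff_isOpen.mpr hO) (hDO hz) hzO
    have hzfr : z ∈ frontier O := by
      rw [hO.frontier_eq]
      exact ⟨closure_mono h hzP, hzO⟩
    have hzD : z ∉ D := by
      intro hzD
      have hzfrP : z ∈ frontier P := by
        rw [hP.frontier_eq]
        exact ⟨hzP, fun hz' => hzO (h hz')⟩
      have := h3 z hzφ z ⟨hzD, hzfrP⟩
      rw [dist_self] at this
      exact this.not_gt hr
    rcases hz with hz | hz
    · exact notMem_closure_diff hP h hcl hunif hzP hzfr hzD hz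
    · exact hzD hz
  obtain ⟨χ, hχ, hχ0, hχ1⟩ := exists_contDiff_cutoff hF hK.isClosed hdisj
  have hsmooth : ContDiff ℝ ∞ fun x => χ x • φ x := hχ.smul h1
  have hcomp : HasCompactSupport fun x => χ x • φ x := h2.smul_left (f := χ)
  have hdist : Disjoint (tsupport fun x => χ x • φ x) D := disjoint_left.mpr fun x hx hxD =>
    hχ0 x (Or.inr hxD) (tsupport_smul_subset_left χ φ hx)
  refine ⟨fun x => χ x • φ x, ⟨hsmooth, hcomp, ?_⟩, fun x hx => ?_, fun x hx => ?_⟩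
  · exact exists_dist_of_isCompact_of_disjoint hcomp hD hdist
  · by_cases hx' : x ∈ tsupport φ
    · simp only [hχ1 x ⟨hx', subset_closure hx⟩, one_smul]
    · simp only [image_eq_zero_of_notMem_tsupport hx', smul_zero]
  · simp only [image_eq_zero_of_notMem_tsupport (hχ0 x (Or.inl (subset_closure hx))), zero_smul]

lemma resW12_mem (hO : IsOpen O) (h : P ⊆ O) {w : W12 O m} (hw : w ∈ W12D O D m) :
    resW12 m hO h w ∈ W12D P (D ∩ frontier P) m := by
  refine map_mem_closure (continuous_resW12 hO h) hw ?_
  rintro v ⟨φ, ⟨h1, h2, r, hr, h3⟩, h4⟩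
  refine ⟨φ, ⟨h1, h2, r, hr, fun x hx y hy => h3 x hx y hy.1⟩, ?_⟩
  exact (coeFn_resL2 h _).trans (ae_mono (Measure.restrict_mono h le_rfl) h4)

lemma extW12_mem (hO : IsOpen O) (hD : IsClosed D) (hDO : D ⊆ frontier O)
    (hP : IsOpen P) (h : P ⊆ O) (hcl : closure P ∩ O ⊆ P)
    (hunif : IsLocallyUniformNear O (frontier O \ D)) {w : W12 P m}
    (hw : w ∈ W12D P (D ∩ frontier P) m) : extW12 m hP h hcl w ∈ W12D O D m := by
  refine map_mem_closure (continuous_extW12 hP h hcl) hw ?_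
  rintro v ⟨φ, hφ, h4⟩
  obtain ⟨ψ, hψ, hψ1, hψ0⟩ := exists_isTestFunction_of_piece hO hD hDO hP h hcl hunif hφ
  refine ⟨ψ, hψ, (coeFn_extL2 hP.measurableSet h (toL2 P m v)).trans
    ((indicator_ae_eq hP.measurableSet h4).trans ?_)⟩
  filter_upwards [ae_restrict_mem hO.measurableSet] with x hxO
  by_cases hx : x ∈ P
  · rw [indicator_of_mem hx, hψ1 x hx]
  · rw [indicator_of_notMem hx, hψ0 x ⟨hxO, hx⟩]

/-- Functions `φ e` with `φ ∈ C_c^∞(O)` belong to the form domain. -/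
lemma exists_mem_W12D_toL2_eq_testL2 (hD : IsClosed D) (hDO : Disjoint D O) {φ : Rd d → ℝ}
    (h1 : ContDiff ℝ ∞ φ) (h2 : HasCompactSupport φ) (h3 : tsupport φ ⊆ O) (e : Cm m) :
    ∃ w ∈ W12D O D m, toL2 O m w = testL2 O h1.continuous h2 e := by
  refine ⟨mkW12 _ _ fun i => isWeakPartial_testL2 i h1 h2 e, subset_closure ?_, rfl⟩
  refine ⟨fun x => φ x • e, ⟨h1.smul contDiff_const, h2.smul_right, ?_⟩,
    coeFn_testL2 h1.continuous h2 e⟩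
  refine exists_dist_of_isCompact_of_disjoint (HasCompactSupport.smul_right h2).isCompact hD ?_
  exact (hDO.symm.mono_left h3).mono_left (tsupport_smul_subset_left φ fun _ => e)

lemma eq_zero_of_forall_inner_W12D_eq_zero (hO : IsOpen O) (hD : IsClosed D) (hDO : Disjoint D O)
    {f : L2 O m} (h : ∀ v ∈ W12D O D m, inner ℂ (toL2 O m v) f = 0) : f = 0 := by
  refine eq_zero_of_forall_integral_smul_eq_zero hO fun φ h1 h2 h3 => ?_
  refine ext_inner_left ℂ fun e => ?_
  obtain ⟨w, hw, hw'⟩ := exists_mem_W12D_toL2_eq_testL2 hD hDO h1 h2 h3 e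
  rw [inner_zero_right, ← inner_testL2 h1.continuous h2, ← hw', h w hw]

/-! ### The form domain as a Hilbert space -/

/-- The Hilbert space `W^{1,2}_D(O)^m`. It is a type of its own, so that its Hilbert space structure
is found by a single instance rather than through two nested subspaces. -/
def FormDomain (O D : Set (Rd d)) (m : ℕ) : Type := W12D O D m

namespace FormDomain

instance : NormedAddCommGroup (FormDomain O D m) :=
  inferInstanceAs (NormedAddCommGroup (W12D O D m))

instance : InnerProductSpace ℂ (FormDomain O D m) where
  toNormedSpace := inferInstanceAs (NormedSpace ℂ (W12D O D m))
  inner v w := inner ℂ (toL2 O m v.1) (toL2 O m w.1) +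
    ∑ i, inner ℂ (grad O m i v.1) (grad O m i w.1)
  norm_sq_eq_re_inner v := norm_sq_eq_re_inner (𝕜 := ℂ) (v.1 : Jet O m)
  conj_inner_symm v w := inner_conj_symm (𝕜 := ℂ) (v.1 : Jet O m) (w.1 : Jet O m)
  add_left u v w := inner_add_left (𝕜 := ℂ) (u.1 : Jet O m) (v.1 : Jet O m) (w.1 : Jet O m)
  smul_left u v k := inner_smul_left (𝕜 := ℂ) (u.1 : Jet O m) (v.1 : Jet O m) k

instance : CompleteSpace (FormDomain O D m) := by
  have h1 : CompleteSpace (W12 O m) := isClosed_W12.completeSpace_coe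
  have h2 : IsClosed (W12D O D m : Set (W12 O m)) := Submodule.isClosed_topologicalClosure _
  exact h2.completeSpace_coe

lemma inner_def (v w : FormDomain O D m) : inner ℂ v w =
    inner ℂ (toL2 O m v.1) (toL2 O m w.1) + ∑ i, inner ℂ (grad O m i v.1) (grad O m i w.1) := rfl

lemma norm_def (w : FormDomain O D m) : ‖w‖ = ‖w.1‖ := rfl

/-- The embedding `W^{1,2}_D(O)^m → L²(O)^m`. -/
def embed (O D : Set (Rd d)) (m : ℕ) : FormDomain O D m →L[ℂ] L2 O m where
  toFun w := toL2 O m w.1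
  map_add' _ _ := rfl
  map_smul' _ _ := rfl
  cont := continuous_toL2.comp continuous_subtype_val

/-- The weak partial derivative `W^{1,2}_D(O)^m → L²(O)^m`. -/
def partialL (O D : Set (Rd d)) (m : ℕ) (i : Fin d) : FormDomain O D m →L[ℂ] L2 O m where
  toFun w := grad O m i w.1
  map_add' _ _ := rfl
  map_smul' _ _ := rfl
  cont := (continuous_grad i).comp continuous_subtype_val

lemma embed_apply (w : FormDomain O D m) : embed O D m w = toL2 O m w.1 := rfl

lemma partialL_apply (i : Fin d) (w : FormDomain O D m) :
    partialL O D m i w = grad O m i w.1 := rfl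

lemma embed_injective (hO : IsOpen O) : Function.Injective (embed O D m) :=
  fun _ _ h => Subtype.ext (toL2_injective hO h)

end FormDomain

/-! ### The divergence form operator on `O` and on the pieces -/

lemma IsBddMeas.memLp {M : Rd d → (Cm m →L[ℂ] Cm m)} (hM : IsBddMeas O M) (u : L2 O m) :
    MemLp (fun x => M x (u x)) 2 (volume.restrict O) := by
  obtain ⟨h1, Λ, hΛ⟩ := hM
  refine (Lp.memLp u).of_le_mul (c := Λ)
    (isBoundedBilinearMap_apply.continuous.comp_aestronglyMeasurable
      (h1.prodMk (Lp.aestronglyMeasurable u))) ?_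
  filter_upwards [hΛ] with x hx
  exact ((M x).le_opNorm _).trans (mul_le_mul_of_nonneg_right hx (norm_nonneg _))

/-- Multiplication by a bounded measurable matrix function, as an operator on `L²(O)^m`. -/
def mulL2 {M : Rd d → (Cm m →L[ℂ] Cm m)} (hM : IsBddMeas O M) : L2 O m →L[ℂ] L2 O m :=
  LinearMap.mkContinuous
    { toFun := fun u => (hM.memLp u).toLp
      map_add' := fun u v => by
        rw [← MemLp.toLp_add]
        refine MemLp.toLp_congr _ _ ?_
        filter_upwards [Lp.coeFn_add u v] with x hx
        simp only [hx, Pi.add_apply, map_add]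
      map_smul' := fun k u => by
        rw [RingHom.id_apply, ← MemLp.toLp_const_smul]
        refine MemLp.toLp_congr _ _ ?_
        filter_upwards [Lp.coeFn_smul k u] with x hx
        simp only [hx, Pi.smul_apply, map_smul] } hM.2.choose fun u => by
    refine Lp.norm_le_mul_norm_of_ae_le_mul ?_
    filter_upwards [hM.2.choose_spec, (hM.memLp u).coeFn_toLp] with x hx h
    simp only [LinearMap.coe_mk, AddHom.coe_mk, h]
    exact ((M x).le_opNorm _).trans (mul_le_mul_of_nonneg_right hx (norm_nonneg _))

lemma inner_mulL2 {M : Rd d → (Cm m →L[ℂ] Cm m)} (hM : IsBddMeas O M) (u v : L2 O m) :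
    inner ℂ v (mulL2 hM u) = pairing O M u v := by
  rw [inner_L2]
  refine integral_congr_ae ?_
  filter_upwards [(hM.memLp u).coeFn_toLp] with x hx
  change inner ℂ (v x) ((MemLp.toLp _ (hM.memLp u) : L2 O m) x) = _
  rw [hx]

open FormDomain in
/-- The bounded operator on the form domain representing the form: `(v | B w) = a(w, v)`. -/
def formOp (D : Set (Rd d)) (A : Coeff O m) : FormDomain O D m →L[ℂ] FormDomain O D m :=
  (∑ i, ∑ j, (partialL O D m i).adjoint ∘L mulL2 (A.ha i j) ∘L partialL O D m j)
    + (∑ i, (partialL O D m i).adjoint ∘L mulL2 (A.hb i) ∘L embed O D m)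
    + (∑ j, (embed O D m).adjoint ∘L mulL2 (A.hc j) ∘L partialL O D m j)
    + (embed O D m).adjoint ∘L mulL2 A.hd ∘L embed O D m

lemma inner_formOp (A : Coeff O m) (v w : FormDomain O D m) :
    inner ℂ v (formOp D A w) = form A w.1 v.1 := by
  simp only [formOp, _root_.add_apply, _root_.sum_apply,
    ContinuousLinearMap.comp_apply, inner_add_right, inner_sum,
    ContinuousLinearMap.adjoint_inner_right, inner_mulL2, FormDomain.embed_apply,
    FormDomain.partialL_apply, form]

/-- The relation defining `L` is the graph of an operator: the embedding of the form domain is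
injective and has dense range. -/
lemma mem_graph_divOp (hO : IsOpen O) (hD : IsClosed D) (hDO : Disjoint D O) (A : Coeff O m)
    {u f : L2 O m} : (u, f) ∈ (divOp O D A).graph ↔ ∃ w : FormDomain O D m,
      FormDomain.embed O D m w = u ∧
        ∀ v : FormDomain O D m, form A w.1 v.1 = inner ℂ (toL2 O m v.1) f := by
  rw [divOp, Submodule.toLinearPMap_graph_eq]
  · constructor
    · rintro ⟨w, hw, h1, h2⟩
      exact ⟨⟨w, hw⟩, h1, fun v => h2 v.1 v.2⟩
    · rintro ⟨w, h1, h2⟩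
      exact ⟨w.1, w.2, h1, fun v hv => h2 ⟨v, hv⟩⟩
  · rintro ⟨u, f⟩ ⟨w, hw, h1, h2⟩ (rfl : u = 0)
    have hw0 : w = 0 := toL2_injective hO (h1.trans (map_zero _).symm)
    refine eq_zero_of_forall_inner_W12D_eq_zero hO hD hDO fun v hv => ?_
    have h := form_smul A 0 w v
    rw [hw0, smul_zero, zero_mul] at h
    rw [← h2 v hv, hw0, h]

lemma hasImagResolventBound_divOp (hO : IsOpen O) (hD : IsClosed D) (hDO : Disjoint D O)
    (A : Coeff O m) (hell : IsElliptic D A) : HasImagResolventBound (divOp O D A) := by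
  obtain ⟨l, hl, h⟩ := hell
  refine hasImagResolventBound_of_form (B := formOp D A) hl (fun w => ?_)
    (FormDomain.embed O D m) fun u f => ?_
  · rw [inner_formOp, FormDomain.norm_def]
    exact h w.1 w.2
  · simp only [mem_graph_divOp hO hD hDO A, inner_formOp]
    rfl

lemma katoWith_iff_abstractKato (A : Coeff O m) {C₁ C₂ : ℝ} :
    KatoWith O D A C₁ C₂ ↔ AbstractKato (divOp O D A) (FormDomain.embed O D m) C₁ C₂ := by
  constructor
  · rintro ⟨h1, h2⟩
    refine ⟨fun u f huf => ?_, fun w => ?_, fun w f hwf => ?_⟩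
    · obtain ⟨w, hw, hwu⟩ := (h1 ▸ LinearPMap.mem_domain_of_mem_graph huf :
        u ∈ (W12D O D m).map (toL2 O m))
      exact ⟨⟨w, hw⟩, hwu⟩
    · have h : FormDomain.embed O D m w ∈ (sqrtOp (divOp O D A)).domain := by
        rw [h1]
        exact ⟨w.1, w.2, rfl⟩
      exact ⟨_, mem_graph_iff_exists.mpr ⟨h, rfl⟩⟩
    · obtain ⟨h, rfl⟩ := mem_graph_iff_exists.mp hwf
      exact h2 w.1 w.2 ⟨_, h⟩ rfl
  · rintro ⟨h1, h2, h3⟩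
    refine ⟨le_antisymm (fun u hu => ?_) ?_, fun w hw u hu => ?_⟩
    · obtain ⟨w, hw⟩ := h1 u _ (mem_graph_iff_exists.mpr ⟨hu, rfl⟩)
      exact ⟨w.1, w.2, hw⟩
    · rintro _ ⟨w, hw, rfl⟩
      obtain ⟨f, hf⟩ := h2 ⟨w, hw⟩
      exact LinearPMap.mem_domain_of_mem_graph hf
    · exact h3 ⟨w, hw⟩ _ (mem_graph_iff_exists.mpr ⟨hu ▸ u.2,
        by congr 1; exact Subtype.ext hu.symm⟩)

/-! ### Passing between `O` and a piece -/

lemma pairing_extL2_left (hP : MeasurableSet P) (h : P ⊆ O) {M : Rd d → (Cm m →L[ℂ] Cm m)}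
    (u : L2 P m) (v : L2 O m) :
    pairing O M (extL2 m hP h u) v = pairing P M u (resL2 m h v) := by
  rw [pairing, setIntegral_eq_of_indicator hP h (g := fun x => inner ℂ (v x) (M x (u x)))]
  · refine integral_congr_ae ?_
    filter_upwards [coeFn_resL2 h v] with x hx
    rw [hx]
  · filter_upwards [coeFn_extL2 hP h u] with x hx
    by_cases hxP : x ∈ P <;> simp [hx, hxP]

lemma pairing_extL2_right (hP : MeasurableSet P) (h : P ⊆ O) {M : Rd d → (Cm m →L[ℂ] Cm m)}
    (u : L2 O m) (v : L2 P m) :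
    pairing O M u (extL2 m hP h v) = pairing P M (resL2 m h u) v := by
  rw [pairing, setIntegral_eq_of_indicator hP h (g := fun x => inner ℂ (v x) (M x (u x)))]
  · refine integral_congr_ae ?_
    filter_upwards [coeFn_resL2 h u] with x hx
    rw [hx]
  · filter_upwards [coeFn_extL2 hP h v] with x hx
    by_cases hxP : x ∈ P <;> simp [hx, hxP]

/-- `P` is a piece of `O`: an open subset, relatively closed in `O`, such that extension by zero
respects the boundary condition on `D`. -/
structure IsPiece (O D P : Set (Rd d)) (m : ℕ) : Prop where
  isOpen : IsOpen P
  subset : P ⊆ O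
  closure_inter : closure P ∩ O ⊆ P
  extW12_mem : ∀ w ∈ W12D P (D ∩ frontier P) m,
    extW12 m isOpen subset closure_inter w ∈ W12D O D m

namespace IsPiece

lemma resW12_extW12 (hO : IsOpen O) (hP : IsPiece O D P m) (w : W12 P m) :
    resW12 m hO hP.subset (extW12 m hP.isOpen hP.subset hP.closure_inter w) = w :=
  W12_ext (resL2_extL2 hP.isOpen.measurableSet hP.subset _)
    fun _ => resL2_extL2 hP.isOpen.measurableSet hP.subset _

/-- Restriction of form domains. -/
def res (hO : IsOpen O) (hP : IsPiece O D P m) (w : FormDomain O D m) :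
    FormDomain P (D ∩ frontier P) m :=
  ⟨resW12 m hO hP.subset w.1, resW12_mem hO hP.subset w.2⟩

/-- Extension by zero between form domains, as a map. -/
def extFun (hP : IsPiece O D P m) (w : FormDomain P (D ∩ frontier P) m) : FormDomain O D m :=
  ⟨extW12 m hP.isOpen hP.subset hP.closure_inter w.1, hP.extW12_mem w.1 w.2⟩

lemma inner_extFun (hO : IsOpen O) (hP : IsPiece O D P m) (v : FormDomain P (D ∩ frontier P) m)
    (w : FormDomain O D m) : inner ℂ (hP.extFun v) w = inner ℂ v (hP.res hO w) := by
  rw [FormDomain.inner_def, FormDomain.inner_def]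
  exact congrArg₂ (· + ·) (inner_extL2 hP.isOpen.measurableSet hP.subset _ _)
    (Finset.sum_congr rfl fun i _ => inner_extL2 hP.isOpen.measurableSet hP.subset _ _)

lemma res_extFun (hO : IsOpen O) (hP : IsPiece O D P m) (w : FormDomain P (D ∩ frontier P) m) :
    hP.res hO (hP.extFun w) = w :=
  Subtype.ext (hP.resW12_extW12 hO w.1)

/-- Extension by zero between form domains, as a linear isometry. -/
def ext (hO : IsOpen O) (hP : IsPiece O D P m) :
    FormDomain P (D ∩ frontier P) m →ₗᵢ[ℂ] FormDomain O D m where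
  toFun := hP.extFun
  map_add' v w := Subtype.ext (map_add (extW12 m hP.isOpen hP.subset hP.closure_inter) v.1 w.1)
  map_smul' k w := Subtype.ext (map_smul (extW12 m hP.isOpen hP.subset hP.closure_inter) k w.1)
  norm_map' := norm_map_of_inner_of_leftInverse (hP.inner_extFun hO) (hP.res_extFun hO)

lemma embed_res (hO : IsOpen O) (hP : IsPiece O D P m) (w : FormDomain O D m) :
    FormDomain.embed P (D ∩ frontier P) m (hP.res hO w) =
      resL2 m hP.subset (FormDomain.embed O D m w) := rfl

lemma embed_ext (hO : IsOpen O) (hP : IsPiece O D P m) (w : FormDomain P (D ∩ frontier P) m) :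
    FormDomain.embed O D m (hP.ext hO w) =
      extL2 m hP.isOpen.measurableSet hP.subset (FormDomain.embed P (D ∩ frontier P) m w) := rfl

lemma form_ext_left (hO : IsOpen O) (hP : IsPiece O D P m) (A : Coeff O m)
    (w : FormDomain P (D ∩ frontier P) m) (v : FormDomain O D m) :
    form A (hP.ext hO w).1 v.1 = form (A.restrict hP.subset) w.1 (hP.res hO v).1 := by
  change form A (extW12 m hP.isOpen hP.subset hP.closure_inter w.1) v.1 =
    form (A.restrict hP.subset) w.1 (resW12 m hO hP.subset v.1)
  simp only [form, toL2_extW12, grad_extW12, toL2_resW12, grad_resW12, pairing_extL2_left]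
  rfl

lemma form_ext_right (hO : IsOpen O) (hP : IsPiece O D P m) (A : Coeff O m)
    (w : FormDomain O D m) (v : FormDomain P (D ∩ frontier P) m) :
    form A w.1 (hP.ext hO v).1 = form (A.restrict hP.subset) (hP.res hO w).1 v.1 := by
  change form A w.1 (extW12 m hP.isOpen hP.subset hP.closure_inter v.1) =
    form (A.restrict hP.subset) (resW12 m hO hP.subset w.1) v.1
  simp only [form, toL2_extW12, grad_extW12, toL2_resW12, grad_resW12, pairing_extL2_right]
  rfl

lemma isElliptic (hO : IsOpen O) (hP : IsPiece O D P m) {A : Coeff O m} (hell : IsElliptic D A) :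
    IsElliptic (D ∩ frontier P) (A.restrict hP.subset) := by
  obtain ⟨l, hl, h⟩ := hell
  refine ⟨l, hl, fun u hu => ?_⟩
  set w : FormDomain P (D ∩ frontier P) m := ⟨u, hu⟩
  have h1 := h (hP.ext hO w).1 (hP.ext hO w).2
  have h2 : hP.res hO (hP.ext hO w) = w := hP.res_extFun hO w
  rw [form_ext_left, h2, ← FormDomain.norm_def, LinearIsometry.norm_map] at h1
  exact h1

end IsPiece

lemma disjoint_inter_frontier (hP : IsOpen P) : Disjoint (D ∩ frontier P) P :=
  (disjoint_frontier_iff_isOpen.mpr hP).mono_left inter_subset_right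

namespace IsPiece

lemma mem_graph_res (hO : IsOpen O) (hD : IsClosed D) (hDO : Disjoint D O)
    (hP : IsPiece O D P m) (A : Coeff O m) {u f : L2 O m} (h : (u, f) ∈ (divOp O D A).graph) :
    (resL2 m hP.subset u, resL2 m hP.subset f) ∈
      (divOp P (D ∩ frontier P) (A.restrict hP.subset)).graph := by
  obtain ⟨w, hu, hw⟩ := (mem_graph_divOp hO hD hDO A).mp h
  refine (mem_graph_divOp hP.isOpen (hD.inter isClosed_frontier)
    (disjoint_inter_frontier hP.isOpen) _).mpr ⟨hP.res hO w, by rw [embed_res, hu], fun v => ?_⟩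
  rw [← form_ext_right, hw]
  exact inner_extL2 hP.isOpen.measurableSet hP.subset _ f

lemma mem_graph_ext (hO : IsOpen O) (hD : IsClosed D) (hDO : Disjoint D O)
    (hP : IsPiece O D P m) (A : Coeff O m) {u f : L2 P m}
    (h : (u, f) ∈ (divOp P (D ∩ frontier P) (A.restrict hP.subset)).graph) :
    (extL2 m hP.isOpen.measurableSet hP.subset u, extL2 m hP.isOpen.measurableSet hP.subset f) ∈
      (divOp O D A).graph := by
  obtain ⟨w, hu, hw⟩ := (mem_graph_divOp hP.isOpen (hD.inter isClosed_frontier)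
    (disjoint_inter_frontier hP.isOpen) _).mp h
  refine (mem_graph_divOp hO hD hDO A).mpr ⟨hP.ext hO w, by rw [embed_ext, hu], fun v => ?_⟩
  rw [form_ext_left, hw, ← inner_conj_symm, ← inner_conj_symm (toL2 O m v.1), inner_extL2]
  rfl

end IsPiece

/-- One set of a partition into open sets is relatively closed in the union. -/
lemma closure_inter_iUnion_subset {ι : Type*} {P : ι → Set (Rd d)} (hPopen : ∀ i, IsOpen (P i))
    (hPdisj : Pairwise fun i j => Disjoint (P i) (P j)) (i : ι) :
    closure (P i) ∩ ⋃ j, P j ⊆ P i := by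
  rintro x ⟨hx, hx'⟩
  obtain ⟨j, hj⟩ := mem_iUnion.mp hx'
  by_cases hij : i = j
  · exact hij ▸ hj
  · exact absurd hj (disjoint_left.mp ((hPdisj hij).closure_left (hPopen j)) hx)

/-- For a decomposition of `O` into pieces, the square root property on `O` is the one on all
pieces. -/
theorem katoWith_iff_forall (hO : IsOpen O) (hD : IsClosed D) (hDO : Disjoint D O)
    {ι : Type*} {P : ι → Set (Rd d)} (hPdisj : Pairwise fun i j => Disjoint (P i) (P j))
    (hPO : O = ⋃ i, P i) (hP : ∀ i, IsPiece O D (P i) m) (A : Coeff O m) (hell : IsElliptic D A)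
    {C₁ C₂ : ℝ} (hC₁ : 0 < C₁) (hC₂ : 0 < C₂) :
    KatoWith O D A C₁ C₂ ↔
      ∀ i, KatoWith (P i) (D ∩ frontier (P i)) (A.restrict (hP i).subset) C₁ C₂ := by
  have hzero : ∀ u : L2 O m, (∀ i, resL2 m (hP i).subset u = 0) → u = 0 := fun u hu =>
    eq_zero_of_resL2_eq_zero (fun i => (hP i).isOpen) hPO (fun i => (hP i).subset) hu
  have hE : IsHilbertSum ℂ (fun i => L2 (P i) m)
      fun i => extL2 m (hP i).isOpen.measurableSet (hP i).subset :=
    isHilbertSum_of_separating (R := fun i => resL2 m (hP i).subset)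
      (fun i x u => inner_extL2 _ _ _ _)
      (fun i j hij x => resL2_extL2_of_disjoint _ _ (hP i).isOpen.measurableSet _
        (hPdisj hij.symm) _) hzero
  have hF : IsHilbertSum ℂ (fun i => FormDomain (P i) (D ∩ frontier (P i)) m)
      fun i => (hP i).ext hO := by
    refine isHilbertSum_of_separating (R := fun i => (hP i).res hO)
      (fun i x u => (hP i).inner_extFun hO x u) (fun i j hij x => ?_) fun w hw => ?_
    · refine FormDomain.embed_injective (hP i).isOpen ?_
      rw [IsPiece.embed_res, IsPiece.embed_ext, map_zero]
      exact resL2_extL2_of_disjoint _ _ (hP i).isOpen.measurableSet _ (hPdisj hij.symm) _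
    · refine FormDomain.embed_injective hO ?_
      rw [map_zero]
      refine hzero _ fun i => ?_
      rw [← IsPiece.embed_res hO (hP i), hw i, map_zero]
  rw [katoWith_iff_abstractKato A,
    forall_congr' fun i => katoWith_iff_abstractKato (A.restrict (hP i).subset)]
  exact abstractKato_iff_forall (hasImagResolventBound_divOp hO hD hDO A hell)
    (fun i => hasImagResolventBound_divOp (hP i).isOpen (hD.inter isClosed_frontier)
      (disjoint_inter_frontier (hP i).isOpen) _ ((hP i).isElliptic hO hell))
    (E := fun i => extL2 m (hP i).isOpen.measurableSet (hP i).subset)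
    (R := fun i => resL2 m (hP i).subset)
    (F := fun i => (hP i).ext hO) (S := fun i => (hP i).res hO)
    hE (fun i x u => inner_extL2 _ _ _ _) hF (fun i x u => (hP i).inner_extFun hO x u) hzero
    (fun i x => resL2_extL2 _ _ _) (fun i x => (hP i).embed_ext hO x) (fun i w => (hP i).embed_res hO w)
    (fun i u f h => (hP i).mem_graph_res hO hD hDO A h)
    (fun i u f h => (hP i).mem_graph_ext hO hD hDO A h) hC₁ hC₂

end KatoRoot

end

theorem mainTheorem4 {d m : ℕ} (hd : 2 ≤ d) {O D : Set (KatoRoot.Rd d)}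
    (hO : IsOpen O) (hD : IsClosed D) (hDO : D ⊆ frontier O)
    (hunif : KatoRoot.IsLocallyUniformNear O (frontier O \ D))
    {ι : Type*} {P : ι → Set (KatoRoot.Rd d)}
    (hPopen : ∀ i, IsOpen (P i)) (hPdisj : Pairwise (fun i j => Disjoint (P i) (P j)))
    (hPO : O = ⋃ i, P i)
    (A : KatoRoot.Coeff O m) (hell : KatoRoot.IsElliptic D A) :
    ((∃ C₁ C₂ : ℝ, 0 < C₁ ∧ 0 < C₂ ∧ KatoRoot.KatoWith O D A C₁ C₂) ↔
      ∃ C₁ C₂ : ℝ, 0 < C₁ ∧ 0 < C₂ ∧ ∀ i,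
        KatoRoot.KatoWith (P i) (D ∩ frontier (P i))
          (A.restrict (hPO ▸ Set.subset_iUnion P i : P i ⊆ O)) C₁ C₂) ∧
    ∀ C₁ C₂ : ℝ, 0 < C₁ → 0 < C₂ →
      (KatoRoot.KatoWith O D A C₁ C₂ ↔
        ∀ i, KatoRoot.KatoWith (P i) (D ∩ frontier (P i))
          (A.restrict (hPO ▸ Set.subset_iUnion P i : P i ⊆ O)) C₁ C₂) := by
  have hsub : ∀ i, P i ⊆ O := fun i => hPO ▸ Set.subset_iUnion P i
  have hcl : ∀ i, closure (P i) ∩ O ⊆ P i := fun i => by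
    rw [hPO]
    exact KatoRoot.closure_inter_iUnion_subset hPopen hPdisj i
  have hDO' : Disjoint D O := (disjoint_frontier_iff_isOpen.mpr hO).mono_left hDO
  have hP : ∀ i, KatoRoot.IsPiece O D (P i) m := fun i =>
    ⟨hPopen i, hsub i, hcl i, fun w hw =>
      KatoRoot.extW12_mem hO hD hDO (hPopen i) (hsub i) (hcl i) hunif hw⟩
  have key : ∀ C₁ C₂ : ℝ, 0 < C₁ → 0 < C₂ → (KatoRoot.KatoWith O D A C₁ C₂ ↔
      ∀ i, KatoRoot.KatoWith (P i) (D ∩ frontier (P i)) (A.restrict (hsub i)) C₁ C₂) :=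
    fun C₁ C₂ => KatoRoot.katoWith_iff_forall hO hD hDO' hPdisj hPO hP A hell
  exact ⟨exists_congr fun C₁ => exists_congr fun C₂ => and_congr_right fun h₁ =>
    and_congr_right fun h₂ => key C₁ C₂ h₁ h₂, key⟩
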